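/- Let $M$ be a smooth Hausdorff $7$-manifold with a smooth positive $3$-form $\omega$, i.e. a $G_2$-structure: at every point, in some basis $e^1,\dots,e^7$ of the cotangent space, $$\omega=(e^{12}-e^{34})\wedge e^5+(e^{13}+e^{24})\wedge e^6+(e^{14}-e^{23})\wedge e^7+e^{567}.$$ (The form $\omega$ is not required to be parallel; in particular $M$ may be any holonomy $G_2$-manifold.) Let $g$ be the Riemannian metric determined by $\omega$: $g=k^{-1}\tilde g$, where $\tilde g(x,y)=\tfrac16(\omega\lrcorner x)\wedge(\omega\lrcorner y)\wedge\omega$ takes values in $\Lambda^7$ and $k=(\det\tilde g)^{1/9}$. Let $\Lambda^2_{14}(M)\subset\Lambda^2(M)$ be the subbundle that corresponds to the Lie algebra $\mathfrak g_2\subset\mathfrak{so}(TM)$ of the stabilizer of $\omega$ under the identification $\mathfrak{so}(TM)\cong\Lambda^2(M)$ given by $g$. Let $C:\Lambda^i(M)\to\Lambda^{i+1}(M)$ be the structure operator of $(M,\omega)$: the $C^\infty(M)$-linear odd derivation of $\Lambda^*(M)$ that vanishes on functions and sends a $1$-form $\nu$ to $\omega\lrcorner\nu^\sharp$. Let $B$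 be a smooth real vector bundle of finite rank on $M$ with a smooth connection $\nabla$ and curvature $\Theta\in\Lambda^2(M)\otimes\operatorname{End}(B)$. Extend $\nabla$ in the usual way to $\nabla:B\otimes\Lambda^i(M)\to B\otimes\Lambda^{i+1}(M)$, extend $C$ to $B\otimes\Lambda^i(M)$ as $\mathrm{id}_B\otimes C$, and put $$\nabla^c:=\{C,\nabla\}=C\nabla+\nabla C:\;B\otimes\Lambda^i(M)\to B\otimes\Lambda^{i+2}(M).$$ Then $(B,\nabla)$ is a Donaldson–Thomas bundle, i.e. $\Theta\in\Lambda^2_{14}(M)\otimes\operatorname{End}(B)$, if and only if $\nabla$ and $\nabla^c$ commute, i.e. $\nabla\nabla^c s=\nabla^c\nabla s$ for every $i\ge 0$ and every smooth section $s$ of $B\otimes\Lambda^i(M)$. -/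

import Mathlib

open Bundle Manifold VectorField
open scoped ContDiff

noncomputable section

namespace GTwo

section LinearAlgebra

variable {W : Type*} [AddCommGroup W] [Module ℝ W]

/-- The structure constants `e^a ∧ e^b ∧ e^c (e_i, e_j, e_k)` for the dual of a basis `e`. -/
def wedge3 (a b c i j k : Fin 7) : ℝ :=
  Matrix.det fun p q : Fin 3 => if (![a, b, c] p : Fin 7) = ![i, j, k] q then (1 : ℝ) else 0

/-- The coefficients of the standard positive 3-form on `ℝ⁷`, which is (with indices from 1 to 7)
`(e¹ ∧ e² - e³ ∧ e⁴) ∧ e⁵ + (e¹ ∧ e³ + e² ∧ e⁴) ∧ e⁶ + (e¹ ∧ e⁴ - e² ∧ e³) ∧ e⁷ + e⁵ ∧ e⁶ ∧ e⁷`. -/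
def stdCoeff (i j k : Fin 7) : ℝ :=
  (wedge3 0 1 4 i j k - wedge3 2 3 4 i j k) + (wedge3 0 2 5 i j k + wedge3 1 3 5 i j k) +
    (wedge3 0 3 6 i j k - wedge3 1 2 6 i j k) + wedge3 4 5 6 i j k

/-- A 3-form on a 7-dimensional space is positive (it lies in the open `GL(7)`-orbit of forms
whose stabilizer is the compact form of `G₂`) if it is the standard form in some basis. -/
def IsPositive (φ : W [⋀^Fin 3]→ₗ[ℝ] ℝ) : Prop :=
  ∃ e : Module.Basis (Fin 7) ℝ W, ∀ i j k, φ ![e i, e j, e k] = stdCoeff i j k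

/-- The `Λ⁷`-valued bilinear form `(x, y) ↦ (1/6) (φ ⌟ x) ∧ (φ ⌟ y) ∧ φ`, as a number: its value
on the basis `b`. The factor `1 / (2! 2! 3!)` belongs to the wedge product. -/
def volForm (b : Module.Basis (Fin 7) ℝ W) (φ : W [⋀^Fin 3]→ₗ[ℝ] ℝ) (x y : W) : ℝ :=
  (1 / 6) * ((1 / 24) * ∑ σ : Equiv.Perm (Fin 7), ((Equiv.Perm.sign σ : ℤ) : ℝ) *
    (φ ![x, b (σ 0), b (σ 1)] * φ ![y, b (σ 2), b (σ 3)] * φ ![b (σ 4), b (σ 5), b (σ 6)]))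

/-- The real ninth root. -/
def ninthRoot (t : ℝ) : ℝ := SignType.sign t * |t| ^ (1 / 9 : ℝ)

/-- The metric `g = k⁻¹ g̃` of a 3-form `φ`, where `g̃(x, y) = (1/6) (φ ⌟ x) ∧ (φ ⌟ y) ∧ φ` and
`k = (det g̃)^{1/9}`. The basis `b` only trivializes `Λ⁷`: the quotient does not depend on it. -/
def metric (b : Module.Basis (Fin 7) ℝ W) (φ : W [⋀^Fin 3]→ₗ[ℝ] ℝ) (x y : W) : ℝ :=
  (ninthRoot (Matrix.det fun i j => volForm b φ (b i) (b j)))⁻¹ * volForm b φ x y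

/-- The cross product: `u × v` is the vector with `g(u × v, w) = φ(u, v, w)` for all `w`. -/
def cross (b : Module.Basis (Fin 7) ℝ W) (φ : W [⋀^Fin 3]→ₗ[ℝ] ℝ) (u v : W) : W :=
  Classical.epsilon fun c : W => ∀ w, metric b φ c w = φ ![u, v, w]

/-- The Lie algebra `𝔤₂` of the stabilizer of `φ`: the endomorphisms annihilating `φ`. -/
def liealg (φ : W [⋀^Fin 3]→ₗ[ℝ] ℝ) : Set (W →ₗ[ℝ] W) :=
  {A | ∀ u v w, φ ![A u, v, w] + φ ![u, A v, w] + φ ![u, v, A w] = 0}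

/-- `Λ²₁₄`: the image of `𝔤₂ ⊆ 𝔰𝔬(W)` under the identification of `𝔰𝔬(W)` with `Λ²` that sends
`A` to the 2-form `g(A u, v)`. -/
def lambda14 (b : Module.Basis (Fin 7) ℝ W) (φ : W [⋀^Fin 3]→ₗ[ℝ] ℝ) :
    Set (W [⋀^Fin 2]→ₗ[ℝ] ℝ) :=
  {α | ∃ A ∈ liealg φ, ∀ u v, α ![u, v] = metric b φ (A u) v}

end LinearAlgebra

section Manifold

/-- The model space of 7-manifolds. -/
abbrev E7 : Type := EuclideanSpace ℝ (Fin 7)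

variable {M : Type*} [TopologicalSpace M] [ChartedSpace E7 M] [IsManifold (𝓡 7) ∞ M]

/-- The basis of the tangent space given by the preferred chart at `x`. -/
def chartBasis (x : M) : Module.Basis (Fin 7) ℝ (TangentSpace (𝓡 7) x) :=
  (EuclideanSpace.basisFun (Fin 7) ℝ).toBasis

/-- Smoothness at `x` of a vector field. -/
def SmoothFieldAt (X : ∀ y : M, TangentSpace (𝓡 7) y) (x : M) : Prop :=
  ContMDiffAt (𝓡 7) ((𝓡 7).prod 𝓘(ℝ, E7)) ∞ (fun y => TotalSpace.mk' E7 y (X y)) x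

/-- A smooth 3-form on `M`: its value on smooth vector fields is smooth. -/
def IsSmoothThreeForm (φ : ∀ x : M, TangentSpace (𝓡 7) x [⋀^Fin 3]→ₗ[ℝ] ℝ) : Prop :=
  ∀ (x : M) (X : Fin 3 → ∀ y : M, TangentSpace (𝓡 7) y), (∀ i, SmoothFieldAt (X i) x) →
    ContMDiffAt (𝓡 7) 𝓘(ℝ, ℝ) ∞ (fun y => φ y fun i => X i y) x

/-- `(M, φ)` is a `G₂`-manifold: `φ` is a smooth 3-form on `M` that is positive everywhere. -/
structure IsG2 (φ : ∀ x : M, TangentSpace (𝓡 7) x [⋀^Fin 3]→ₗ[ℝ] ℝ) : Prop where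
  smooth : IsSmoothThreeForm φ
  positive : ∀ x, IsPositive (φ x)

variable (F : Type*) [NormedAddCommGroup F] [NormedSpace ℝ F]
  {B : M → Type*} [TopologicalSpace (TotalSpace F B)]
  [∀ x, AddCommGroup (B x)] [∀ x, Module ℝ (B x)] [∀ x, TopologicalSpace (B x)]
  [∀ x, IsTopologicalAddGroup (B x)] [∀ x, ContinuousSMul ℝ (B x)] [FiberBundle F B]

/-- Families of functions of `k` tangent vectors with values in `B`. The `B`-valued `k`-forms are
those that satisfy `IsSmoothForm`. -/
abbrev Family (B : M → Type*) (k : ℕ) := ∀ x : M, (Fin k → TangentSpace (𝓡 7) x) → B x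

/-- `s` is a smooth `k`-form on `M` with values in `B`, i.e. a section of `B ⊗ Λᵏ(M)`: it is
alternating and multilinear, and its value on smooth vector fields is a smooth section of `B`. -/
structure IsSmoothForm {k : ℕ} (s : Family B k) : Prop where
  alternating : ∀ x, ∃ a : TangentSpace (𝓡 7) x [⋀^Fin k]→ₗ[ℝ] B x, ∀ v, s x v = a v
  smooth : ∀ (x : M) (X : Fin k → ∀ y : M, TangentSpace (𝓡 7) y), (∀ i, SmoothFieldAt (X i) x) →
    ContMDiffAt (𝓡 7) ((𝓡 7).prod 𝓘(ℝ, F)) ∞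
      (fun y => TotalSpace.mk' F y (s y fun i => X i y)) x

variable {F}

/-- The extension of a tangent vector to a vector field, smooth near `x`. -/
def ext {x : M} (v : TangentSpace (𝓡 7) x) (y : M) : TangentSpace (𝓡 7) y :=
  FiberBundle.extend (E := fun z : M => TangentSpace (𝓡 7) z) E7 v y

/-- The terms with Lie brackets in the invariant formula for the exterior derivative,
`∑_{i < j} (-1)^{i + j} s([V_i, V_j], V_0, …, V̂_i, …, V̂_j, …, V_k)` at `x`, for the extensions
`V_i` of the vectors `v_i`. The pair `(i, j)` in the code stands for `(i, j + 1)` here, hence the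
minus sign. -/
def bracketTerms : {k : ℕ} → Family B k → ∀ x : M, (Fin (k + 1) → TangentSpace (𝓡 7) x) → B x
  | 0, _, _, _ => 0
  | k + 1, s, x, v => -∑ i : Fin (k + 1), ∑ j ≥ i, (-1 : ℝ) ^ ((i : ℕ) + (j : ℕ)) •
      s x (Fin.cons (mlieBracket (𝓡 7) (ext (v i.castSucc)) (ext (v j.succ)) x)
        (j.removeNth (i.castSucc.removeNth v)))

/-- The extension `∇ : B ⊗ Λᵏ(M) → B ⊗ Λᵏ⁺¹(M)` of a connection to forms with values in `B`,
`(∇s)(V_0, …, V_k) = ∑_i (-1)^i ∇_{V_i} (s(V_0, …, V̂_i, …, V_k))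
  + ∑_{i < j} (-1)^{i + j} s([V_i, V_j], V_0, …, V̂_i, …, V̂_j, …, V_k)`;
the value of the right hand side at `x` depends only on the values of the fields at `x`. -/
def extCov (D : CovariantDerivative (𝓡 7) F B) {k : ℕ} (s : Family B k) : Family B (k + 1) :=
  fun x v =>
    (∑ i : Fin (k + 1), (-1 : ℝ) ^ (i : ℕ) •
      D (fun y => s y (i.removeNth fun j => ext (v j) y)) x (v i)) + bracketTerms s x v

/-- The structure operator `C : B ⊗ Λᵏ(M) → B ⊗ Λᵏ⁺¹(M)` of `(M, φ)`: the `C^∞`-linear odd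
derivation that is 0 on functions and sends a 1-form `ν` to `φ ⌟ ν♯`, i.e. to the 2-form
`ν(u × v)`, extended to `B`-valued forms. Explicitly, it is
`(C s)(v_0, …, v_k) = ∑_{i < j} (-1)^{i + j - 1} s(v_i × v_j, v_0, …, v̂_i, …, v̂_j, …, v_k)`;
again `(i, j)` in the code stands for `(i, j + 1)` here. -/
def structureOp (φ : ∀ x : M, TangentSpace (𝓡 7) x [⋀^Fin 3]→ₗ[ℝ] ℝ) :
    {k : ℕ} → Family B k → Family B (k + 1)
  | 0, _ => fun _ _ => 0
  | k + 1, s => fun x v => ∑ i : Fin (k + 1), ∑ j ≥ i, (-1 : ℝ) ^ ((i : ℕ) + (j : ℕ)) •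
      s x (Fin.cons (cross (chartBasis x) (φ x) (v i.castSucc) (v j.succ))
        (j.removeNth (i.castSucc.removeNth v)))

/-- The operator `∇ᶜ = {C, ∇} = C ∇ + ∇ C : B ⊗ Λᵏ(M) → B ⊗ Λᵏ⁺²(M)`. -/
def twisted (φ : ∀ x : M, TangentSpace (𝓡 7) x [⋀^Fin 3]→ₗ[ℝ] ℝ) (D : CovariantDerivative (𝓡 7) F B)
    {k : ℕ} (s : Family B k) : Family B (k + 2) :=
  fun x v => structureOp φ (extCov D s) x v + extCov D (structureOp φ s) x v

/-- The curvature `Θ(u, v) b = ∇_U ∇_V σ - ∇_V ∇_U σ - ∇_{[U, V]} σ` at `x`, for extensions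
`U`, `V`, `σ` of `u`, `v`, `b`. -/
def curvature (D : CovariantDerivative (𝓡 7) F B) (x : M) (u v : TangentSpace (𝓡 7) x) (b : B x) : B x :=
  D (fun y => D (FiberBundle.extend F b) y (ext v y)) x u -
    D (fun y => D (FiberBundle.extend F b) y (ext u y)) x v -
    D (FiberBundle.extend F b) x (mlieBracket (𝓡 7) (ext u) (ext v) x)

/-- The subspace `Λ²₁₄ ⊗ End B` at `x`, spanned by the products `α ⊗ f`. -/
def lambda14End (B : M → Type*) [∀ x, AddCommGroup (B x)] [∀ x, Module ℝ (B x)]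
    (φ : ∀ x : M, TangentSpace (𝓡 7) x [⋀^Fin 3]→ₗ[ℝ] ℝ) (x : M) :
    Submodule ℝ (TangentSpace (𝓡 7) x → TangentSpace (𝓡 7) x → B x → B x) :=
  Submodule.span ℝ {Ψ | ∃ α ∈ lambda14 (chartBasis x) (φ x), ∃ f : B x →ₗ[ℝ] B x,
    Ψ = fun u v b => α ![u, v] • f b}

/-- `(B, ∇)` is a Donaldson–Thomas bundle: its curvature lies in `Λ²₁₄(M) ⊗ End B`. -/
def IsDonaldsonThomas (φ : ∀ x : M, TangentSpace (𝓡 7) x [⋀^Fin 3]→ₗ[ℝ] ℝ)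
    (D : CovariantDerivative (𝓡 7) F B) : Prop :=
  ∀ x, curvature D x ∈ lambda14End B φ x

end Manifold

end GTwo

end

/-!
The commutator of the two operators collapses to one tensor. Since `∇ᶜ = C ∇ + ∇ C`,
`∇ ∇ᶜ - ∇ᶜ ∇ = ∇² C - C ∇²`, and `∇²` is exterior multiplication by the curvature `Θ`
(`extCov_extCov`). So `∇` and `∇ᶜ` commute if and only if, at every point, `Θ ∧ C s = C (Θ ∧ s)` for
all forms `s` (`extCov_twisted_eq_iff`). This is a statement about alternating maps on one tangent
space.

The identity `Θ ∧ C s = C (Θ ∧ s)` follows in all degrees from its case of degree 0, which says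
`C (Θ ∧ s) = 0` because `C` vanishes on forms of degree 0. Indeed, for a 1-form `l`, the operator
`Θ ∧ ·` commutes with `l ∧ ·`, and `C (l ∧ s) = C l ∧ s - l ∧ C s`, where `C l ∧ ·` commutes with
`Θ ∧ ·`; so the commutator of `C` and `Θ ∧ ·` anticommutes with `l ∧ ·`, and it vanishes if it
vanishes in degree 0 (`derivationOp_endWedge_comm`). On the scalar components of `Θ`, the condition
`C α = 0` for a 2-form `α = g(A ·, ·)` reads `α(u × v, w) - α(u × w, v) + α(v × w, u) = 0`. By
`g(u × v, w) = φ(u, v, w)` the left hand side is `-(φ(A u, v, w) + φ(u, A v, w) + φ(u, v, A w))`, so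
`C α = 0` means that `A` annihilates `φ`, i.e. `α ∈ Λ²₁₄` (`mem_lambda14_iff`,
`mem_span_lambda14_iff`).

The remaining work is to see that the definitions mean what they should. The metric given by the
`Λ⁷`-valued pairing is the one for which the adapted bases are orthonormal: `volForm` is multiplied
by a determinant when the basis changes (`volForm_change_basis`), the ninth root cancels it
(`metric_change_basis`), and in an adapted basis the pairing is diagonal by symmetry
(`stdPairing_of_ne`), with diagonal entries found by evaluating the sum over the permutations of
seven elements (`stdPairing_self`). On the analytic side, the extensions of tangent vectors in the
definition of `extCov` are coordinate fields of a chart, so they commute; the formula for `extCov`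
does not change when they are replaced by other commuting fields (`extCov_apply_fields`), and this
gives `extCov` of a smooth form near a point, hence smoothness and `∇²`.
-/

noncomputable section

namespace GTwo

/-! ### Alternating maps: exterior multiplication by scalar 1-forms and by 2-forms -/

section AlternatingAlgebra

open AlternatingMap

variable {V N : Type*} [AddCommGroup V] [Module ℝ V] [AddCommGroup N] [Module ℝ N]
variable {k : ℕ}

theorem neg_one_pow_int_smul (n : ℕ) (x : N) : ((-1 : ℤ) ^ n) • x = ((-1 : ℝ) ^ n) • x := by
  rcases Nat.even_or_odd n with h | h <;> simp [h.neg_one_pow]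

/-- Exterior multiplication `s ↦ l ∧ s` by a scalar 1-form `l`. -/
def wedgeOne (l : V →ₗ[ℝ] ℝ) : (V [⋀^Fin k]→ₗ[ℝ] N) →ₗ[ℝ] V [⋀^Fin (k + 1)]→ₗ[ℝ] N :=
  alternatizeUncurryFinLM ∘ₗ LinearMap.smulRightₗ l

theorem wedgeOne_apply (l : V →ₗ[ℝ] ℝ) (s : V [⋀^Fin k]→ₗ[ℝ] N) (v : Fin (k + 1) → V) :
    wedgeOne l s v = ∑ i : Fin (k + 1), (-1 : ℝ) ^ (i : ℕ) • l (v i) • s (i.removeNth v) := by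
  simp only [wedgeOne, LinearMap.comp_apply, alternatizeUncurryFinLM_apply,
    alternatizeUncurryFin_apply, neg_one_pow_int_smul]
  rfl

/-- The exterior product of a 2-form and a `k`-form whose pairing is already carried out: `f` is
bilinear with values in `k`-forms, and only its antisymmetric part matters. -/
def wedgeTwo (f : V →ₗ[ℝ] V →ₗ[ℝ] V [⋀^Fin k]→ₗ[ℝ] N) : V [⋀^Fin (k + 2)]→ₗ[ℝ] N :=
  (1 / 2 : ℝ) • alternatizeUncurryFin (alternatizeUncurryFinLM ∘ₗ f)

theorem wedgeTwo_apply_of_antisymm (f : V →ₗ[ℝ] V →ₗ[ℝ] V [⋀^Fin k]→ₗ[ℝ] N)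
    (hf : ∀ u w, f w u = -f u w) (v : Fin (k + 2) → V) :
    wedgeTwo f v = ∑ i : Fin (k + 1), ∑ j ≥ i, (-1 : ℝ) ^ ((i : ℕ) + (j : ℕ)) •
      f (v i.castSucc) (v j.succ) (j.removeNth (i.castSucc.removeNth v)) := by
  rw [wedgeTwo, AlternatingMap.smul_apply, alternatizeUncurryFin_alternatizeUncurryFinLM_comp_apply,
    Finset.smul_sum]
  refine Finset.sum_congr rfl fun i _ => ?_
  rw [Finset.smul_sum]
  refine Finset.sum_congr rfl fun j _ => ?_
  rw [hf (v i.castSucc) (v j.succ), neg_one_pow_int_smul, AlternatingMap.neg_apply]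
  module

/-- The double alternating sum without restriction on the order of the indices. -/
theorem wedgeTwo_apply (f : V →ₗ[ℝ] V →ₗ[ℝ] V [⋀^Fin k]→ₗ[ℝ] N) (v : Fin (k + 2) → V) :
    wedgeTwo f v = (1 / 2 : ℝ) • ∑ i : Fin (k + 2), (-1 : ℝ) ^ (i : ℕ) • ∑ j : Fin (k + 1),
      (-1 : ℝ) ^ (j : ℕ) • f (v i) (i.removeNth v j) (j.removeNth (i.removeNth v)) := by
  simp only [wedgeTwo, AlternatingMap.smul_apply, alternatizeUncurryFin_apply, neg_one_pow_int_smul,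
    LinearMap.comp_apply, alternatizeUncurryFinLM_apply]

theorem wedgeTwo_add (f g : V →ₗ[ℝ] V →ₗ[ℝ] V [⋀^Fin k]→ₗ[ℝ] N) :
    wedgeTwo (f + g) = wedgeTwo f + wedgeTwo g := by
  simp [wedgeTwo, LinearMap.comp_add]

theorem wedgeOne_comm (l m : V →ₗ[ℝ] ℝ) (s : V [⋀^Fin k]→ₗ[ℝ] N) :
    wedgeOne l (wedgeOne m s) = -wedgeOne m (wedgeOne l s) := by
  rw [eq_neg_iff_add_eq_zero]
  have key := alternatizeUncurryFin_alternatizeUncurryFinLM_comp_of_symmetric (R := ℝ) (n := k)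
    (f := l.smulRight (m.smulRight s) + m.smulRight (l.smulRight s)) (fun x y => by
      simp [smul_smul, mul_comm, add_comm])
  rw [LinearMap.comp_add, alternatizeUncurryFin_add] at key
  convert key using 2 <;>
  · simp only [wedgeOne, LinearMap.comp_apply, alternatizeUncurryFinLM_apply]
    congr 1
    ext u : 1
    simp only [LinearMap.coe_comp, Function.comp_apply, LinearMap.smulRight_apply,
      LinearMap.smulRightₗ_apply_apply, map_smul]
    simp [LinearMap.smulRightₗ]

/-- Contraction is an antiderivation for multiplication by 1-forms. -/
theorem curryLeft_wedgeOne (l : V →ₗ[ℝ] ℝ) (s : V [⋀^Fin (k + 1)]→ₗ[ℝ] N) (a : V) :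
    (wedgeOne l s).curryLeft a = l a • s - wedgeOne l (s.curryLeft a) := by
  ext v
  rw [curryLeft_apply_apply, wedgeOne_apply, Fin.sum_univ_succ, AlternatingMap.sub_apply,
    wedgeOne_apply, sub_eq_add_neg, ← Finset.sum_neg_distrib]
  congr 1
  · simp [Matrix.vecCons, Fin.removeNth_zero]
  · refine Finset.sum_congr rfl fun i _ => ?_
    have : (i.succ.removeNth (Matrix.vecCons a v) : Fin (k + 1) → V)
        = Matrix.vecCons a (i.removeNth v) := by
      ext j
      refine Fin.cases ?_ (fun j => ?_) j <;> simp [Fin.removeNth_apply, Matrix.vecCons]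
    rw [this, curryLeft_apply_apply]
    simp [pow_succ, Matrix.vecCons]

theorem curryLeft_wedgeOne_zero (l : V →ₗ[ℝ] ℝ) (s : V [⋀^Fin 0]→ₗ[ℝ] N) (a : V) :
    (wedgeOne l s).curryLeft a = l a • s := by
  ext v
  rw [curryLeft_apply_apply, wedgeOne_apply]
  simp [Subsingleton.elim (α := Fin 0 → V) _ v]

variable {ι : Type*} [Fintype ι]

theorem eq_sum_smulRight_coord (b : Module.Basis ι ℝ V) {N' : Type*} [AddCommGroup N']
    [Module ℝ N'] (f : V →ₗ[ℝ] N') : f = ∑ a, (b.coord a).smulRight (f (b a)) := by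
  refine b.ext fun i => ?_
  classical
  simp [LinearMap.sum_apply, Finsupp.single_apply]

/-- Every form of positive degree is a sum of products of 1-forms with forms. -/
theorem eq_sum_wedgeOne_curryLeft (b : Module.Basis ι ℝ V) (s : V [⋀^Fin (k + 1)]→ₗ[ℝ] N) :
    s = ((k : ℝ) + 1)⁻¹ • ∑ a, wedgeOne (b.coord a) (s.curryLeft (b a)) := by
  have h := alternatizeUncurryFin_curryLeft s
  have hk : ((k : ℝ) + 1) ≠ 0 := by positivity
  rw [eq_inv_smul_iff₀ hk]
  calc ((k : ℝ) + 1) • s = (k + 1) • s := by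
        rw [← Nat.cast_smul_eq_nsmul ℝ]; push_cast; rfl
    _ = alternatizeUncurryFinLM (R := ℝ) (curryLeft s) := h.symm
    _ = _ := by
      conv_lhs => rw [eq_sum_smulRight_coord b (curryLeft s)]
      rw [map_sum]
      rfl

theorem wedgeTwo_eq_sum (b : Module.Basis ι ℝ V) (f : V →ₗ[ℝ] V →ₗ[ℝ] V [⋀^Fin k]→ₗ[ℝ] N) :
    wedgeTwo f = (1 / 2 : ℝ) • ∑ i, ∑ j, wedgeOne (b.coord i) (wedgeOne (b.coord j)
      (f (b i) (b j))) := by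
  rw [wedgeTwo]
  congr 1
  change alternatizeUncurryFinLM (R := ℝ) (alternatizeUncurryFinLM ∘ₗ f) = _
  conv_lhs => rw [eq_sum_smulRight_coord b (alternatizeUncurryFinLM ∘ₗ f)]
  rw [map_sum]
  refine Finset.sum_congr rfl fun i _ => ?_
  change wedgeOne (b.coord i) (alternatizeUncurryFinLM (f (b i))) = _
  conv_lhs => rw [eq_sum_smulRight_coord b (f (b i))]
  simp only [map_sum]
  rfl

/-- The odd derivation of forms attached to a bilinear product `c` of vectors. It vanishes on
functions and sends a 1-form `ν` to the antisymmetric part of `ν(c(u, w))`. -/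
def derivationOp (c : V →ₗ[ℝ] V →ₗ[ℝ] V) : {k : ℕ} → (V [⋀^Fin k]→ₗ[ℝ] N) →
    V [⋀^Fin (k + 1)]→ₗ[ℝ] N
  | 0, _ => 0
  | _ + 1, s => wedgeTwo (c.compr₂ s.curryLeft)

/-- Composition of endomorphisms of `N` with a fixed `N`-valued form. -/
def compForm (s : V [⋀^Fin k]→ₗ[ℝ] N) : (N →ₗ[ℝ] N) →ₗ[ℝ] V [⋀^Fin k]→ₗ[ℝ] N where
  toFun g := g.compAlternatingMap s
  map_add' _ _ := rfl
  map_smul' _ _ := rfl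

@[simp]
theorem compForm_apply (s : V [⋀^Fin k]→ₗ[ℝ] N) (g : N →ₗ[ℝ] N) :
    compForm s g = g.compAlternatingMap s := rfl

/-- The product `Θ ∧ s` of an `End N`-valued bilinear form with an `N`-valued form. -/
def endWedge (Θ : V →ₗ[ℝ] V →ₗ[ℝ] N →ₗ[ℝ] N) (s : V [⋀^Fin k]→ₗ[ℝ] N) :
    V [⋀^Fin (k + 2)]→ₗ[ℝ] N :=
  wedgeTwo (Θ.compr₂ (compForm s))

theorem endWedge_eq_sum (b : Module.Basis ι ℝ V) (Θ : V →ₗ[ℝ] V →ₗ[ℝ] N →ₗ[ℝ] N)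
    (s : V [⋀^Fin k]→ₗ[ℝ] N) :
    endWedge Θ s = (1 / 2 : ℝ) • ∑ i, ∑ j, wedgeOne (b.coord i) (wedgeOne (b.coord j)
      ((Θ (b i) (b j)).compAlternatingMap s)) :=
  wedgeTwo_eq_sum b _

theorem compAlternatingMap_wedgeOne (g : N →ₗ[ℝ] N) (l : V →ₗ[ℝ] ℝ) (s : V [⋀^Fin k]→ₗ[ℝ] N) :
    g.compAlternatingMap (wedgeOne l s) = wedgeOne l (g.compAlternatingMap s) := by
  ext v
  simp [wedgeOne_apply]

theorem endWedge_wedgeOne (b : Module.Basis ι ℝ V) (Θ : V →ₗ[ℝ] V →ₗ[ℝ] N →ₗ[ℝ] N)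
    (l : V →ₗ[ℝ] ℝ) (s : V [⋀^Fin k]→ₗ[ℝ] N) :
    endWedge Θ (wedgeOne l s) = wedgeOne l (endWedge Θ s) := by
  have h : ∀ i j, wedgeOne (b.coord i) (wedgeOne (b.coord j)
      ((Θ (b i) (b j)).compAlternatingMap (wedgeOne l s))) =
      wedgeOne l (wedgeOne (b.coord i) (wedgeOne (b.coord j)
        ((Θ (b i) (b j)).compAlternatingMap s))) := fun i j => by
    rw [compAlternatingMap_wedgeOne, wedgeOne_comm (b.coord j) l, map_neg,
      wedgeOne_comm (b.coord i) l, neg_neg]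
  rw [endWedge_eq_sum b, endWedge_eq_sum b, map_smul, map_sum]
  simp only [h, map_sum]

theorem endWedge_add (Θ : V →ₗ[ℝ] V →ₗ[ℝ] N →ₗ[ℝ] N) (s t : V [⋀^Fin k]→ₗ[ℝ] N) :
    endWedge Θ (s + t) = endWedge Θ s + endWedge Θ t := by
  rw [endWedge, endWedge, endWedge, ← wedgeTwo_add]
  congr 1
  ext u w v
  simp

theorem wedgeTwo_smul (r : ℝ) (f : V →ₗ[ℝ] V →ₗ[ℝ] V [⋀^Fin k]→ₗ[ℝ] N) :
    wedgeTwo (r • f) = r • wedgeTwo f := by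
  simp [wedgeTwo, LinearMap.comp_smul, smul_comm r]

theorem endWedge_smul (Θ : V →ₗ[ℝ] V →ₗ[ℝ] N →ₗ[ℝ] N) (r : ℝ) (s : V [⋀^Fin k]→ₗ[ℝ] N) :
    endWedge Θ (r • s) = r • endWedge Θ s := by
  rw [endWedge, endWedge, ← wedgeTwo_smul]
  congr 1
  ext u w v
  simp

theorem derivationOp_add (c : V →ₗ[ℝ] V →ₗ[ℝ] V) (s t : V [⋀^Fin k]→ₗ[ℝ] N) :
    derivationOp c (s + t) = derivationOp c s + derivationOp c t := by
  cases k with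
  | zero => simp [derivationOp]
  | succ k =>
    rw [derivationOp, derivationOp, derivationOp, ← wedgeTwo_add]
    congr 1

theorem derivationOp_smul (c : V →ₗ[ℝ] V →ₗ[ℝ] V) (r : ℝ) (s : V [⋀^Fin k]→ₗ[ℝ] N) :
    derivationOp c (r • s) = r • derivationOp c s := by
  cases k with
  | zero => simp [derivationOp]
  | succ k =>
    rw [derivationOp, derivationOp, ← wedgeTwo_smul]
    congr 1

/-- The product `cl ∧ s`, where `cl` is the 2-form `l(c(u, w))`. -/
def wedgeComp (c : V →ₗ[ℝ] V →ₗ[ℝ] V) (l : V →ₗ[ℝ] ℝ) (s : V [⋀^Fin k]→ₗ[ℝ] N) :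
    V [⋀^Fin (k + 2)]→ₗ[ℝ] N :=
  wedgeTwo (c.compr₂ (l.smulRight s))

/-- The operator `derivationOp c` is an odd derivation. -/
theorem derivationOp_wedgeOne (b : Module.Basis ι ℝ V) (c : V →ₗ[ℝ] V →ₗ[ℝ] V)
    (l : V →ₗ[ℝ] ℝ) (s : V [⋀^Fin k]→ₗ[ℝ] N) :
    derivationOp c (wedgeOne l s) = wedgeComp c l s - wedgeOne l (derivationOp c s) := by
  cases k with
  | zero =>
    simp only [derivationOp, _root_.map_zero, sub_zero, wedgeComp]
    congr 2
    ext a : 1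
    exact curryLeft_wedgeOne_zero l s a
  | succ k =>
    simp only [derivationOp, wedgeComp, wedgeTwo_eq_sum b, map_smul, map_sum, ← smul_sub,
      ← Finset.sum_sub_distrib]
    congr 1
    refine Finset.sum_congr rfl fun i _ => Finset.sum_congr rfl fun j _ => ?_
    rw [wedgeOne_comm l (b.coord i), wedgeOne_comm l (b.coord j), map_neg, neg_neg, ← map_sub,
      ← map_sub]
    congr 2
    simp [curryLeft_wedgeOne]

theorem endWedge_wedgeComp (b : Module.Basis ι ℝ V) (Θ : V →ₗ[ℝ] V →ₗ[ℝ] N →ₗ[ℝ] N)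
    (c : V →ₗ[ℝ] V →ₗ[ℝ] V) (l : V →ₗ[ℝ] ℝ) (s : V [⋀^Fin k]→ₗ[ℝ] N) :
    endWedge Θ (wedgeComp c l s) = wedgeComp c l (endWedge Θ s) := by
  have h : ∀ {m : ℕ} (t : V [⋀^Fin m]→ₗ[ℝ] N), wedgeComp c l t = (1 / 2 : ℝ) • ∑ i, ∑ j,
      l (c (b i) (b j)) • wedgeOne (b.coord i) (wedgeOne (b.coord j) t) := fun t => by
    simp [wedgeComp, wedgeTwo_eq_sum b]
  have hs : ∀ {m : ℕ} (t : ι → V [⋀^Fin m]→ₗ[ℝ] N),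
      endWedge Θ (∑ a, t a) = ∑ a, endWedge Θ (t a) := fun {m} t =>
    map_sum (⟨⟨endWedge Θ, endWedge_add Θ⟩, endWedge_smul Θ⟩ :
      (V [⋀^Fin m]→ₗ[ℝ] N) →ₗ[ℝ] V [⋀^Fin (m + 2)]→ₗ[ℝ] N) t _
  simp only [h, endWedge_smul, hs, endWedge_wedgeOne b]

/-- If `C(Θ ∧ s) = 0` for all 0-forms `s`, then `Θ ∧ ·` commutes with the derivation `C`. On
products `l ∧ s` the commutator anticommutes with `l ∧ ·`, so it is determined by its values on
0-forms. -/
theorem derivationOp_endWedge_comm (b : Module.Basis ι ℝ V) (Θ : V →ₗ[ℝ] V →ₗ[ℝ] N →ₗ[ℝ] N)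
    (c : V →ₗ[ℝ] V →ₗ[ℝ] V)
    (h0 : ∀ s : V [⋀^Fin 0]→ₗ[ℝ] N, derivationOp c (endWedge Θ s) = 0) :
    ∀ {k : ℕ} (s : V [⋀^Fin k]→ₗ[ℝ] N),
      derivationOp c (endWedge Θ s) = endWedge Θ (derivationOp c s) := by
  intro k
  induction k with
  | zero =>
    intro s
    rw [h0, derivationOp]
    simpa using (endWedge_smul Θ 0 (0 : V [⋀^Fin 1]→ₗ[ℝ] N)).symm
  | succ k ih =>
    have h1 : ∀ (l : V →ₗ[ℝ] ℝ) (s : V [⋀^Fin k]→ₗ[ℝ] N),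
        derivationOp c (endWedge Θ (wedgeOne l s)) =
          endWedge Θ (derivationOp c (wedgeOne l s)) := fun l s => by
      have hsub : ∀ {m : ℕ} (s t : V [⋀^Fin m]→ₗ[ℝ] N),
          endWedge Θ (s - t) = endWedge Θ s - endWedge Θ t := fun s t => by
        rw [sub_eq_add_neg, ← neg_one_smul ℝ t, endWedge_add, endWedge_smul]
        module
      rw [endWedge_wedgeOne b, derivationOp_wedgeOne b, derivationOp_wedgeOne b, hsub,
        endWedge_wedgeOne b, ih, endWedge_wedgeComp b]
    intro s
    let K : (V [⋀^Fin (k + 1)]→ₗ[ℝ] N) →ₗ[ℝ] V [⋀^Fin (k + 4)]→ₗ[ℝ] N :=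
      { toFun := fun s => derivationOp c (endWedge Θ s) - endWedge Θ (derivationOp c s)
        map_add' := fun s t => by
          simp only [endWedge_add, derivationOp_add]
          abel
        map_smul' := fun r s => by
          simp only [endWedge_smul, derivationOp_smul, RingHom.id_apply, smul_sub] }
    have hK : K s = 0 := by
      rw [eq_sum_wedgeOne_curryLeft b s, map_smul, map_sum]
      have : ∀ a, K (wedgeOne (b.coord a) (s.curryLeft (b a))) = 0 := fun a =>
        sub_eq_zero.2 (h1 _ _)
      simp [this]
    exact sub_eq_zero.1 hK

end AlternatingAlgebra

/-! ### Evaluation of the volume pairing of the standard 3-form -/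

section Computation

/-- The coefficients of the standard positive 3-form, as integers. -/
def stdInt (i j k : Fin 7) : ℤ :=
  let w (a b c : Fin 7) : ℤ :=
    let d (p q : Fin 7) : ℤ := if p = q then 1 else 0
    d a i * d b j * d c k - d a i * d b k * d c j - d a j * d b i * d c k +
      d a j * d b k * d c i + d a k * d b i * d c j - d a k * d b j * d c i
  (w 0 1 4 - w 2 3 4) + (w 0 2 5 + w 1 3 5) + (w 0 3 6 - w 1 2 6) + w 4 5 6

theorem wedge3_eq (a b c i j k : Fin 7) : wedge3 a b c i j k =
    (((if a = i then 1 else 0) * (if b = j then 1 else 0) * (if c = k then 1 else 0) -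
      (if a = i then 1 else 0) * (if b = k then 1 else 0) * (if c = j then 1 else 0) -
      (if a = j then 1 else 0) * (if b = i then 1 else 0) * (if c = k then 1 else 0) +
      (if a = j then 1 else 0) * (if b = k then 1 else 0) * (if c = i then 1 else 0) +
      (if a = k then 1 else 0) * (if b = i then 1 else 0) * (if c = j then 1 else 0) -
      (if a = k then 1 else 0) * (if b = j then 1 else 0) * (if c = i then 1 else 0) : ℤ) : ℝ) := by
  push_cast
  exact Matrix.det_fin_three _

theorem stdCoeff_eq (i j k : Fin 7) : stdCoeff i j k = (stdInt i j k : ℝ) := by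
  simp only [stdCoeff, stdInt, wedge3_eq]
  push_cast
  rfl

/-- The function `stdInt` as a table: `stdInt i j k + 1` is the digit with index `49 i + 7 j + k`
of a number in base 4. The kernel looks up digits quickly. -/
def stdTable (i j k : Fin 7) : ℤ :=
  ((
    0x1555515595555515595515595595555515555515551595559515595555555595515555155955595595515555595515515555515559595515555595551555595515555995515555555155515551555195559555955555
      >>> (2 * (49 * (i : ℕ) + 7 * j + k)) % 4 : ℕ) : ℤ) - 1

theorem stdInt_eq_stdTable : ∀ i j k, stdInt i j k = stdTable i j k := by
  decide +kernel

/-- The alternating sum of a function of `n`-tuples over the rearrangements of a tuple `v`. -/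
def altSum {ι : Type*} : {n : ℕ} → ((Fin n → ι) → ℤ) → (Fin n → ι) → ℤ
  | 0, f, v => f v
  | _ + 1, f, v => ∑ p, (if p = 0 then 1 else -1) *
      altSum (fun w => f (Fin.cons (v p) w)) fun i => v (Equiv.swap 0 p i.succ)

theorem altSum_eq {ι : Type*} {n : ℕ} (f : (Fin n → ι) → ℤ) (v : Fin n → ι) :
    altSum f v = ∑ σ : Equiv.Perm (Fin n), ((Equiv.Perm.sign σ : ℤˣ) : ℤ) * f (v ∘ σ) := by
  induction n with
  | zero =>
    simp [altSum]
  | succ n ih =>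
    rw [altSum, ← Equiv.Perm.decomposeFin.symm.sum_comp, Fintype.sum_prod_type]
    refine Finset.sum_congr rfl fun p _ => ?_
    rw [ih, Finset.mul_sum]
    refine Finset.sum_congr rfl fun e _ => ?_
    rw [Equiv.Perm.decomposeFin.symm_sign]
    have : (v ∘ Equiv.Perm.decomposeFin.symm (p, e)) =
        Fin.cons (v p) ((fun i : Fin n => v (Equiv.swap 0 p i.succ)) ∘ e) := by
      ext i
      refine Fin.cases ?_ (fun i => ?_) i
      · simp
      · simp [Equiv.Perm.decomposeFin_symm_apply_succ]
    rw [this]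
    split_ifs <;> simp

theorem altSum_mul {ι : Type*} {n : ℕ} (c : ℤ) (f : (Fin n → ι) → ℤ) (v : Fin n → ι) :
    altSum (fun w => c * f w) v = c * altSum f v := by
  simp only [altSum_eq, Finset.mul_sum]
  exact Finset.sum_congr rfl fun _ _ => by ring

/-- Multiplication that does not evaluate the second factor if the first one is 0. -/
def lazyMul (c : ℤ) (r : Unit → ℤ) : ℤ := if c = 0 then 0 else c * r ()

theorem lazyMul_eq (c : ℤ) (r : Unit → ℤ) : lazyMul c r = c * r () := by
  unfold lazyMul
  split_ifs with h <;> simp [h]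

/-- The alternating sum of `stdInt i a b * stdInt j c d * stdInt p q r` over the permutations
`(a, b, c, d, p, q, r)` of the indices, with vanishing branches cut. -/
def stdPairing (i j : Fin 7) : ℤ :=
  let next {n : ℕ} (v : Fin (n + 1) → Fin 7) (p : Fin (n + 1)) : Fin n → Fin 7 :=
    fun i => v (Equiv.swap 0 p i.succ)
  let sgn {n : ℕ} (p : Fin (n + 1)) : ℤ := if p = 0 then 1 else -1
  let v : Fin 7 → Fin 7 := id
  ∑ a, sgn a * ∑ b, sgn b * lazyMul (stdTable i (v a) (next v a b)) fun _ =>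
    let v := next (next v a) b
    ∑ c, sgn c * ∑ d, sgn d * lazyMul (stdTable j (v c) (next v c d)) fun _ =>
      let v := next (next v c) d
      altSum (fun w => stdTable (w 0) (w 1) (w 2)) v

theorem stdPairing_eq (i j : Fin 7) : stdPairing i j =
    ∑ σ : Equiv.Perm (Fin 7), ((Equiv.Perm.sign σ : ℤˣ) : ℤ) *
      (stdInt i (σ 0) (σ 1) * stdInt j (σ 2) (σ 3) * stdInt (σ 4) (σ 5) (σ 6)) := by
  have h := altSum_eq (fun w : Fin 7 → Fin 7 => stdInt i (w 0) (w 1) *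
    (stdInt j (w 2) (w 3) * stdInt (w 4) (w 5) (w 6))) id
  simp only [Function.id_comp] at h
  simp only [mul_assoc]
  rw [← h]
  refine Finset.sum_congr rfl fun a _ => congrArg _ ?_
  refine Finset.sum_congr rfl fun b _ => congrArg _ ?_
  rw [lazyMul_eq]
  refine Eq.trans ?_ (altSum_mul (stdInt i _ _)
    (fun w : Fin 5 → Fin 7 => stdInt j (w 0) (w 1) * stdInt (w 2) (w 3) (w 4)) _).symm
  rw [stdInt_eq_stdTable]
  refine congrArg _ ?_
  refine Finset.sum_congr rfl fun c _ => congrArg _ ?_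
  refine Finset.sum_congr rfl fun d _ => congrArg _ ?_
  rw [lazyMul_eq]
  refine Eq.trans ?_ (altSum_mul (stdInt j _ _)
    (fun w : Fin 3 → Fin 7 => stdInt (w 0) (w 1) (w 2)) _).symm
  simp only [stdInt_eq_stdTable]
  rfl

theorem stdPairing_self : ∀ i, stdPairing i i = -144 := by
  decide +kernel

/-- Three sign changes of the coordinates that preserve the standard 3-form. -/
def signChange (m : Fin 3) : Fin 7 → ℤ :=
  ![![-1, -1, -1, -1, 1, 1, 1], ![1, -1, 1, -1, -1, 1, -1], ![1, 1, -1, -1, 1, -1, -1]] m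

theorem signChange_mul_stdInt : ∀ m i j k,
    signChange m i * signChange m j * signChange m k * stdInt i j k = stdInt i j k := by
  simp only [stdInt_eq_stdTable]
  decide +kernel

theorem exists_signChange : ∀ i j, i ≠ j → ∃ m, signChange m i * signChange m j = -1 := by
  decide

theorem prod_signChange : ∀ m, ∏ i, signChange m i = 1 := by
  decide

theorem stdPairing_of_ne {i j : Fin 7} (hij : i ≠ j) : stdPairing i j = 0 := by
  obtain ⟨m, hm⟩ := exists_signChange i j hij
  rw [stdPairing_eq]
  refine Finset.sum_eq_zero fun σ _ => mul_eq_zero_of_right _ ?_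
  have hp : ∏ k, signChange m (σ k) = 1 := by
    rw [Equiv.prod_comp σ (signChange m), prod_signChange]
  simp only [Fin.prod_univ_seven] at hp
  have h1 := signChange_mul_stdInt m i (σ 0) (σ 1)
  have h2 := signChange_mul_stdInt m j (σ 2) (σ 3)
  have h3 := signChange_mul_stdInt m (σ 4) (σ 5) (σ 6)
  generalize stdInt i (σ 0) (σ 1) = A at *
  generalize stdInt j (σ 2) (σ 3) = B at *
  generalize stdInt (σ 4) (σ 5) (σ 6) = C at *
  have : A * B * C = -(A * B * C) := by
    calc A * B * C = (signChange m i * signChange m j) * (signChange m (σ 0) * signChange m (σ 1) *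
          signChange m (σ 2) * signChange m (σ 3) * signChange m (σ 4) * signChange m (σ 5) *
          signChange m (σ 6)) * (A * B * C) := by
          conv_lhs => rw [← h1, ← h2, ← h3]
          ring
      _ = -(A * B * C) := by rw [hm, hp]; ring
  omega

end Computation

/-! ### The metric of a positive 3-form -/

section Metric

variable {W : Type*} [AddCommGroup W] [Module ℝ W]

section Slots

variable (φ : W [⋀^Fin 3]→ₗ[ℝ] ℝ)

theorem map_add_fst (x y b c : W) : φ ![x + y, b, c] = φ ![x, b, c] + φ ![y, b, c] :=
  φ.map_vecCons_add _ _ _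

theorem map_smul_fst (r : ℝ) (x b c : W) : φ ![r • x, b, c] = r * φ ![x, b, c] :=
  φ.map_vecCons_smul _ _ _

theorem map_swap_fst (a b c : W) : φ ![b, a, c] = -φ ![a, b, c] := by
  have := φ.map_swap ![a, b, c] (i := 0) (j := 1) (by decide)
  rw [← this]
  congr 1
  ext i
  fin_cases i <;> rfl

theorem map_swap_snd (a b c : W) : φ ![a, c, b] = -φ ![a, b, c] := by
  have := φ.map_swap ![a, b, c] (i := 1) (j := 2) (by decide)
  rw [← this]
  congr 1
  ext i
  fin_cases i <;> rfl

theorem map_add_snd (a x y c : W) : φ ![a, x + y, c] = φ ![a, x, c] + φ ![a, y, c] := by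
  rw [map_swap_fst, map_add_fst, map_swap_fst φ a x, map_swap_fst φ a y]
  ring

theorem map_smul_snd (r : ℝ) (a x c : W) : φ ![a, r • x, c] = r * φ ![a, x, c] := by
  rw [map_swap_fst, map_smul_fst, map_swap_fst φ a x]
  ring

theorem map_add_thd (a b x y : W) : φ ![a, b, x + y] = φ ![a, b, x] + φ ![a, b, y] := by
  rw [map_swap_snd, map_add_snd, map_swap_snd φ a x, map_swap_snd φ a y]
  ring

theorem map_smul_thd (r : ℝ) (a b x : W) : φ ![a, b, r • x] = r * φ ![a, b, x] := by
  rw [map_swap_snd, map_smul_snd, map_swap_snd φ a x]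
  ring

end Slots

/-- The multilinear map whose alternatization is the 7-form `(φ ⌟ x) ∧ (φ ⌟ y) ∧ φ`, up to a
factor. -/
def preVolume (φ : W [⋀^Fin 3]→ₗ[ℝ] ℝ) (x y : W) : MultilinearMap ℝ (fun _ : Fin 7 => W) ℝ where
  toFun v := φ ![x, v 0, v 1] * φ ![y, v 2, v 3] * φ ![v 4, v 5, v 6]
  map_update_add' {inst} v i a b := by
    obtain rfl : inst = instDecidableEqFin 7 := Subsingleton.elim _ _
    fin_cases i <;>
      simp [map_add_fst, map_add_snd, map_add_thd] <;> ring
  map_update_smul' {inst} v i r a := by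
    obtain rfl : inst = instDecidableEqFin 7 := Subsingleton.elim _ _
    fin_cases i <;>
      simp [map_smul_fst, map_smul_snd, map_smul_thd] <;> ring

theorem preVolume_apply (φ : W [⋀^Fin 3]→ₗ[ℝ] ℝ) (x y : W) (v : Fin 7 → W) :
    preVolume φ x y v = φ ![x, v 0, v 1] * φ ![y, v 2, v 3] * φ ![v 4, v 5, v 6] := rfl

theorem volForm_eq_alternatization (b : Module.Basis (Fin 7) ℝ W) (φ : W [⋀^Fin 3]→ₗ[ℝ] ℝ)
    (x y : W) :
    volForm b φ x y = (1 / 144) * MultilinearMap.alternatization (preVolume φ x y) b := by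
  have h : MultilinearMap.alternatization (preVolume φ x y) b =
      ∑ σ : Equiv.Perm (Fin 7), ((Equiv.Perm.sign σ : ℤ) : ℝ) *
        (φ ![x, b (σ 0), b (σ 1)] * φ ![y, b (σ 2), b (σ 3)] * φ ![b (σ 4), b (σ 5), b (σ 6)]) := by
    rw [MultilinearMap.alternatization_apply]
    refine Finset.sum_congr rfl fun σ _ => ?_
    rw [Units.smul_def, zsmul_eq_mul, MultilinearMap.domDomCongr_apply, preVolume_apply]
  rw [h, volForm]
  ring

theorem volForm_change_basis (b e : Module.Basis (Fin 7) ℝ W) (φ : W [⋀^Fin 3]→ₗ[ℝ] ℝ)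
    (x y : W) : volForm b φ x y = e.det b * volForm e φ x y := by
  have h : ∀ f : W [⋀^Fin 7]→ₗ[ℝ] ℝ, f b = e.det b * f e := fun f => by
    conv_lhs => rw [f.eq_smul_basis_det e]
    rw [AlternatingMap.smul_apply, smul_eq_mul, mul_comm]
  rw [volForm_eq_alternatization, volForm_eq_alternatization, h]
  ring

/-- The form `volForm b φ` as a bilinear map. -/
def volBilin (b : Module.Basis (Fin 7) ℝ W) (φ : W [⋀^Fin 3]→ₗ[ℝ] ℝ) : W →ₗ[ℝ] W →ₗ[ℝ] ℝ :=
  LinearMap.mk₂ ℝ (volForm b φ)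
    (fun x x' y => by
      simp only [volForm, map_add_fst, ← mul_add, ← Finset.sum_add_distrib]
      congr 2
      exact Finset.sum_congr rfl fun _ _ => by ring)
    (fun r x y => by
      simp only [volForm, map_smul_fst, Finset.mul_sum, smul_eq_mul]
      exact Finset.sum_congr rfl fun _ _ => by ring)
    (fun x y y' => by
      simp only [volForm, map_add_fst, ← mul_add, ← Finset.sum_add_distrib]
      congr 2
      exact Finset.sum_congr rfl fun _ _ => by ring)
    (fun r x y => by
      simp only [volForm, map_smul_fst, Finset.mul_sum, smul_eq_mul]
      exact Finset.sum_congr rfl fun _ _ => by ring)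

@[simp]
theorem volBilin_apply (b : Module.Basis (Fin 7) ℝ W) (φ : W [⋀^Fin 3]→ₗ[ℝ] ℝ) (x y : W) :
    volBilin b φ x y = volForm b φ x y := rfl

/-- The determinant of the Gram matrix of `volForm b φ` in the basis `b`. -/
def gramDet (b : Module.Basis (Fin 7) ℝ W) (φ : W [⋀^Fin 3]→ₗ[ℝ] ℝ) : ℝ :=
  Matrix.det fun i j => volForm b φ (b i) (b j)

theorem gramDet_change_basis (b e : Module.Basis (Fin 7) ℝ W) (φ : W [⋀^Fin 3]→ₗ[ℝ] ℝ) :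
    gramDet b φ = e.det b ^ 9 * gramDet e φ := by
  have h : (Matrix.of fun i j => volForm b φ (b i) (b j)) = e.det b •
      ((e.toMatrix b).transpose * (Matrix.of fun i j => volForm e φ (e i) (e j)) *
        e.toMatrix b) := by
    ext i j
    rw [Matrix.of_apply, volForm_change_basis b e, Matrix.smul_apply, smul_eq_mul]
    congr 1
    rw [← volBilin_apply]
    conv_lhs => rw [← e.sum_repr (b i), ← e.sum_repr (b j)]
    simp only [map_sum, LinearMap.sum_apply, map_smul, LinearMap.smul_apply, volBilin_apply,
      Matrix.mul_apply, Matrix.transpose_apply, Module.Basis.toMatrix_apply, Matrix.of_apply,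
      smul_eq_mul, Finset.sum_mul, Finset.mul_sum]
    exact Finset.sum_congr rfl fun k _ => Finset.sum_congr rfl fun l _ => by ring
  have h' := congrArg Matrix.det h
  rw [Matrix.det_smul, Matrix.det_mul, Matrix.det_mul, Matrix.det_transpose,
    ← Module.Basis.det_apply, Fintype.card_fin] at h'
  calc gramDet b φ = _ := h'
    _ = e.det b ^ 9 * (Matrix.of fun i j => volForm e φ (e i) (e j)).det := by ring
    _ = _ := rfl

theorem ninthRoot_pow_mul (p t : ℝ) : ninthRoot (p ^ 9 * t) = p * ninthRoot t := by
  have hs : (SignType.sign (p ^ 9) : SignType) = SignType.sign p := by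
    rw [sign_pow]
    generalize SignType.sign p = q
    cases q <;> rfl
  have ha : |p ^ 9| ^ (1 / 9 : ℝ) = |p| := by
    rw [abs_pow, ← Real.rpow_natCast, ← Real.rpow_mul (abs_nonneg p)]
    norm_num
  rw [ninthRoot, ninthRoot, sign_mul, hs, abs_mul, Real.mul_rpow (abs_nonneg _) (abs_nonneg _), ha]
  have : ((SignType.sign p : SignType) : ℝ) * |p| = p := sign_mul_abs p
  push_cast
  linear_combination (SignType.sign t * |t| ^ (1 / 9 : ℝ) : ℝ) * this

theorem ninthRoot_ne_zero {t : ℝ} (ht : t ≠ 0) : ninthRoot t ≠ 0 := by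
  refine mul_ne_zero ?_ (Real.rpow_pos_of_pos (abs_pos.2 ht) _).ne'
  rcases lt_or_gt_of_ne ht with h | h <;> simp [h]

theorem metric_change_basis (b e : Module.Basis (Fin 7) ℝ W) (φ : W [⋀^Fin 3]→ₗ[ℝ] ℝ) :
    metric b φ = metric e φ := by
  ext x y
  have hd : e.det b ≠ 0 := e.isUnit_det b |>.ne_zero
  change (ninthRoot (gramDet b φ))⁻¹ * _ = (ninthRoot (gramDet e φ))⁻¹ * _
  rw [gramDet_change_basis b e, ninthRoot_pow_mul, volForm_change_basis b e, mul_inv]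
  field_simp

/-- In a basis that is adapted to a positive 3-form the volume pairing is diagonal. -/
theorem volForm_adapted (e : Module.Basis (Fin 7) ℝ W) (φ : W [⋀^Fin 3]→ₗ[ℝ] ℝ)
    (he : ∀ i j k, φ ![e i, e j, e k] = stdCoeff i j k) (i j : Fin 7) :
    volForm e φ (e i) (e j) = if i = j then -1 else 0 := by
  have h : ∑ σ : Equiv.Perm (Fin 7), ((Equiv.Perm.sign σ : ℤ) : ℝ) *
      (φ ![e i, e (σ 0), e (σ 1)] * φ ![e j, e (σ 2), e (σ 3)] * φ ![e (σ 4), e (σ 5), e (σ 6)])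
      = ((stdPairing i j : ℤ) : ℝ) := by
    simp only [he, stdCoeff_eq, stdPairing_eq]
    push_cast
    rfl
  rw [volForm, h]
  split_ifs with hij
  · subst hij
    rw [stdPairing_self]
    norm_num
  · rw [stdPairing_of_ne hij]
    norm_num

/-- The metric as a bilinear map. -/
def metricBilin (b : Module.Basis (Fin 7) ℝ W) (φ : W [⋀^Fin 3]→ₗ[ℝ] ℝ) : W →ₗ[ℝ] W →ₗ[ℝ] ℝ :=
  (ninthRoot (gramDet b φ))⁻¹ • volBilin b φ

theorem metricBilin_apply (b : Module.Basis (Fin 7) ℝ W) (φ : W [⋀^Fin 3]→ₗ[ℝ] ℝ) (x y : W) :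
    metricBilin b φ x y = metric b φ x y := rfl

/-- A basis adapted to a positive 3-form is orthonormal. -/
theorem metric_adapted (e : Module.Basis (Fin 7) ℝ W) (φ : W [⋀^Fin 3]→ₗ[ℝ] ℝ)
    (he : ∀ i j k, φ ![e i, e j, e k] = stdCoeff i j k) (i j : Fin 7) :
    metric e φ (e i) (e j) = if i = j then 1 else 0 := by
  have hg : gramDet e φ = -1 := by
    rw [gramDet]
    simp only [volForm_adapted e φ he]
    have : (fun i j : Fin 7 => if i = j then (-1 : ℝ) else 0) =
        (-1 : Matrix (Fin 7) (Fin 7) ℝ) := by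
      ext i j
      simp only [Matrix.neg_apply, Matrix.one_apply]
      split_ifs <;> simp
    rw [this, Matrix.det_neg]
    norm_num
  have hr : ninthRoot (-1) = -1 := by simp [ninthRoot]
  change (ninthRoot (gramDet e φ))⁻¹ * _ = _
  rw [hg, hr, volForm_adapted e φ he]
  split_ifs <;> norm_num

end Metric

section Cross

variable {W : Type*} [AddCommGroup W] [Module ℝ W]
  (b : Module.Basis (Fin 7) ℝ W) {φ : W [⋀^Fin 3]→ₗ[ℝ] ℝ}

theorem metricBilin_change_basis (b e : Module.Basis (Fin 7) ℝ W) (φ : W [⋀^Fin 3]→ₗ[ℝ] ℝ) :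
    metricBilin b φ = metricBilin e φ := by
  ext x y
  rw [metricBilin_apply, metricBilin_apply, metric_change_basis b e]

theorem cross_change_basis (b e : Module.Basis (Fin 7) ℝ W) (φ : W [⋀^Fin 3]→ₗ[ℝ] ℝ) (u v : W) :
    cross b φ u v = cross e φ u v := by
  simp only [cross, metric_change_basis b e]

/-- The metric of a positive 3-form has an orthonormal basis. -/
theorem IsPositive.exists_orthonormal (hφ : IsPositive φ) : ∃ e : Module.Basis (Fin 7) ℝ W,
    ∀ i j, metricBilin b φ (e i) (e j) = if i = j then 1 else 0 := by
  obtain ⟨e, he⟩ := hφ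
  refine ⟨e, fun i j => ?_⟩
  rw [metricBilin_change_basis b e, metricBilin_apply, metric_adapted e φ he]

theorem IsPositive.metric_comm (hφ : IsPositive φ) (x y : W) :
    metricBilin b φ x y = metricBilin b φ y x := by
  obtain ⟨e, he⟩ := hφ.exists_orthonormal b
  have : metricBilin b φ = (metricBilin b φ).flip := by
    refine LinearMap.ext_basis e e fun i j => ?_
    rw [LinearMap.flip_apply, he, he]
    simp only [eq_comm]
  exact LinearMap.congr_fun₂ this x y

theorem IsPositive.eq_of_metric_eq (hφ : IsPositive φ) {x y : W}
    (h : ∀ w, metricBilin b φ x w = metricBilin b φ y w) : x = y := by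
  obtain ⟨e, he⟩ := hφ.exists_orthonormal b
  have hc : ∀ z i, metricBilin b φ z (e i) = e.repr z i := fun z i => by
    conv_lhs => rw [← e.sum_repr z]
    simp only [map_sum, LinearMap.sum_apply, map_smul, LinearMap.smul_apply, he]
    simp
  exact e.ext_elem fun i => by rw [← hc, ← hc, h]

/-- Every linear form is represented by the metric. -/
theorem IsPositive.exists_metric_eq (hφ : IsPositive φ) (l : W →ₗ[ℝ] ℝ) :
    ∃ c, ∀ w, metricBilin b φ c w = l w := by
  obtain ⟨e, he⟩ := hφ.exists_orthonormal b
  refine ⟨∑ i, l (e i) • e i, fun w => ?_⟩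
  conv_rhs => rw [← e.sum_repr w]
  conv_lhs => rw [← e.sum_repr w]
  simp only [map_sum, LinearMap.sum_apply, map_smul, LinearMap.smul_apply, he]
  simp [mul_comm]

theorem IsPositive.metric_cross (hφ : IsPositive φ) (u v w : W) :
    metricBilin b φ (cross b φ u v) w = φ ![u, v, w] := by
  obtain ⟨c, hc⟩ := hφ.exists_metric_eq b
    { toFun := fun w => φ ![u, v, w]
      map_add' := fun x y => map_add_thd φ u v x y
      map_smul' := fun r x => map_smul_thd φ r u v x }
  exact Classical.epsilon_spec (p := fun c : W => ∀ w, metric b φ c w = φ ![u, v, w]) ⟨c, hc⟩ w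

theorem gramDet_ne_zero (hφ : IsPositive φ) : gramDet b φ ≠ 0 := by
  intro h
  obtain ⟨e, he⟩ := hφ.exists_orthonormal b
  have := he 0 0
  rw [metricBilin, h] at this
  simp [ninthRoot] at this

/-- The cross product of a positive 3-form as a bilinear map. -/
def crossBilin (hφ : IsPositive φ) : W →ₗ[ℝ] W →ₗ[ℝ] W :=
  LinearMap.mk₂ ℝ (cross b φ)
    (fun u u' v => hφ.eq_of_metric_eq b fun w => by
      simp only [map_add, LinearMap.add_apply, hφ.metric_cross, map_add_fst])
    (fun r u v => hφ.eq_of_metric_eq b fun w => by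
      simp only [map_smul, LinearMap.smul_apply, hφ.metric_cross, map_smul_fst, smul_eq_mul])
    (fun u v v' => hφ.eq_of_metric_eq b fun w => by
      simp only [map_add, LinearMap.add_apply, hφ.metric_cross, map_add_snd])
    (fun r u v => hφ.eq_of_metric_eq b fun w => by
      simp only [map_smul, LinearMap.smul_apply, hφ.metric_cross, map_smul_snd, smul_eq_mul])

@[simp]
theorem crossBilin_apply (hφ : IsPositive φ) (u v : W) : crossBilin b hφ u v = cross b φ u v := rfl

theorem cross_swap (hφ : IsPositive φ) (u v : W) : cross b φ v u = -cross b φ u v :=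
  hφ.eq_of_metric_eq b fun w => by
    rw [map_neg, LinearMap.neg_apply, hφ.metric_cross, hφ.metric_cross, map_swap_fst]

theorem derivationOp_apply {N : Type*} [AddCommGroup N] [Module ℝ N] {k : ℕ} (hφ : IsPositive φ)
    (s : W [⋀^Fin (k + 1)]→ₗ[ℝ] N) (v : Fin (k + 2) → W) :
    derivationOp (crossBilin b hφ) s v = ∑ i : Fin (k + 1), ∑ j ≥ i,
      (-1 : ℝ) ^ ((i : ℕ) + (j : ℕ)) • s (Fin.cons (cross b φ (v i.castSucc) (v j.succ))
        (j.removeNth (i.castSucc.removeNth v))) := by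
  rw [derivationOp, wedgeTwo_apply_of_antisymm _ fun u w => by
    simp only [LinearMap.compr₂_apply, crossBilin_apply, cross_swap b hφ u w, map_neg]]
  rfl

theorem derivationOp_two_apply {N : Type*} [AddCommGroup N] [Module ℝ N] (hφ : IsPositive φ)
    (α : W [⋀^Fin 2]→ₗ[ℝ] N) (u v w : W) : derivationOp (crossBilin b hφ) α ![u, v, w] =
      α ![cross b φ u v, w] - α ![cross b φ u w, v] + α ![cross b φ v w, u] := by
  rw [derivationOp_apply, Fin.sum_univ_two]
  have e1 : (Finset.Ici (0 : Fin 2)) = {0, 1} := by decide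
  have e2 : (Finset.Ici (1 : Fin 2)) = {1} := by decide
  rw [e1, e2, Finset.sum_pair (by decide), Finset.sum_singleton]
  have r1 : ((0 : Fin 2).removeNth ((0 : Fin 2).castSucc.removeNth ![u, v, w]) : Fin 1 → W) =
      ![w] := by
    ext i; fin_cases i; rfl
  have r2 : ((1 : Fin 2).removeNth ((0 : Fin 2).castSucc.removeNth ![u, v, w]) : Fin 1 → W) =
      ![v] := by
    ext i; fin_cases i; rfl
  have r3 : ((1 : Fin 2).removeNth ((1 : Fin 2).castSucc.removeNth ![u, v, w]) : Fin 1 → W) =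
      ![u] := by
    ext i; fin_cases i; rfl
  rw [r1, r2, r3]
  simp [sub_eq_add_neg]

theorem twoForm_swap {N : Type*} [AddCommGroup N] [Module ℝ N] (α : W [⋀^Fin 2]→ₗ[ℝ] N) (u v : W) :
    α ![v, u] = -α ![u, v] := by
  have := α.map_swap ![u, v] (i := 0) (j := 1) (by decide)
  rw [← this]
  congr 1
  ext i
  fin_cases i <;> rfl

/-- `Λ²₁₄` is the kernel of the structure operator on 2-forms: for `α = g(A ·, ·)` the 3-form
`C α` is, up to sign, the derivative of `φ` along `A`. -/
theorem mem_lambda14_iff (hφ : IsPositive φ) (α : W [⋀^Fin 2]→ₗ[ℝ] ℝ) :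
    α ∈ lambda14 b φ ↔ derivationOp (crossBilin b hφ) α = 0 := by
  -- Both sides speak of an endomorphism `A` with `α = g(A ·, ·)`.
  have key : ∀ A : W →ₗ[ℝ] W, (∀ u v, α ![u, v] = metricBilin b φ (A u) v) → ∀ u v w,
      derivationOp (crossBilin b hφ) α ![u, v, w] =
        -(φ ![A u, v, w] + φ ![u, A v, w] + φ ![u, v, A w]) := fun A hA u v w => by
    have h : ∀ x y z, α ![cross b φ x y, z] = -φ ![x, y, A z] := fun x y z => by
      rw [twoForm_swap, hA, hφ.metric_comm b, hφ.metric_cross]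
    rw [derivationOp_two_apply, h, h, h, map_swap_snd φ u (A v) w, map_swap_snd φ v (A u) w,
      map_swap_fst φ (A u) v w]
    ring
  constructor
  · rintro ⟨A, hA, hα⟩
    ext x
    have hx : x = ![x 0, x 1, x 2] := by ext i; fin_cases i <;> rfl
    rw [hx, key A hα, hA]
    simp
  · intro h
    have hex : ∀ u, ∃ c, ∀ w, metricBilin b φ c w = α ![u, w] := fun u => by
      obtain ⟨c, hc⟩ := hφ.exists_metric_eq b
        { toFun := fun w => α ![u, w]
          map_add' := fun x y => by
            rw [twoForm_swap, α.map_vecCons_add, twoForm_swap, twoForm_swap α u y]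
            abel
          map_smul' := fun r x => by
            rw [twoForm_swap, α.map_vecCons_smul, twoForm_swap]
            simp }
      exact ⟨c, hc⟩
    choose A hA using hex
    let A' : W →ₗ[ℝ] W :=
      { toFun := A
        map_add' := fun x y => hφ.eq_of_metric_eq b fun w => by
          rw [map_add, LinearMap.add_apply, hA, hA, hA, α.map_vecCons_add]
        map_smul' := fun r x => hφ.eq_of_metric_eq b fun w => by
          rw [map_smul, LinearMap.smul_apply, hA]
          simp [hA, α.map_vecCons_smul] }
    refine ⟨A', fun u v w => ?_, fun u v => (hA u v).symm⟩
    have := key A' (fun u v => (hA u v).symm) u v w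
    rw [h, AlternatingMap.zero_apply] at this
    exact neg_eq_zero.1 this.symm

end Cross

/-! ### Endomorphism-valued 2-forms in the kernel of the structure operator -/

section EndValued

variable {W N : Type*} [AddCommGroup W] [Module ℝ W] [AddCommGroup N] [Module ℝ N]
  (b : Module.Basis (Fin 7) ℝ W) {φ : W [⋀^Fin 3]→ₗ[ℝ] ℝ}

/-- The 2-form `Θ(u, v) n` for a fixed vector `n`, which is how a 0-form is multiplied by `Θ`. -/
theorem endWedge_zero_apply (Θ : W →ₗ[ℝ] W →ₗ[ℝ] N →ₗ[ℝ] N) (hΘ : ∀ u v, Θ v u = -Θ u v)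
    (s : W [⋀^Fin 0]→ₗ[ℝ] N) (u v : W) : endWedge Θ s ![u, v] = Θ u v (s ![]) := by
  rw [endWedge, wedgeTwo_apply_of_antisymm _ fun u w => by
    simp only [LinearMap.compr₂_apply, hΘ u w, map_neg], Fin.sum_univ_one]
  have e1 : Finset.Ici (0 : Fin 1) = {0} := by decide
  rw [e1, Finset.sum_singleton]
  simp [Subsingleton.elim (α := Fin 0 → W) _ ![]]

theorem derivationOp_compAlternatingMap (c : W →ₗ[ℝ] W →ₗ[ℝ] W) {N' : Type*} [AddCommGroup N']
    [Module ℝ N'] (f : N →ₗ[ℝ] N') {k : ℕ} (s : W [⋀^Fin (k + 1)]→ₗ[ℝ] N) :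
    derivationOp c (f.compAlternatingMap s) = f.compAlternatingMap (derivationOp c s) := by
  ext v
  simp only [derivationOp, wedgeTwo_apply, LinearMap.compAlternatingMap_apply, map_smul, map_sum,
    LinearMap.compr₂_apply]
  rfl

/-- A 2-form with values in `End N` is a sum of products of elements of `Λ²₁₄` and endomorphisms
if and only if the structure operator annihilates the 2-forms `Θ(·, ·) n`. -/
theorem mem_span_lambda14_iff [FiniteDimensional ℝ N] (hφ : IsPositive φ)
    (Θ : W →ₗ[ℝ] W →ₗ[ℝ] N →ₗ[ℝ] N) (hΘ : ∀ u v, Θ v u = -Θ u v) :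
    (fun u v n => Θ u v n) ∈ Submodule.span ℝ {Ψ : W → W → N → N | ∃ α ∈ lambda14 b φ,
      ∃ f : N →ₗ[ℝ] N, Ψ = fun u v n => α ![u, v] • f n} ↔
    ∀ s : W [⋀^Fin 0]→ₗ[ℝ] N, derivationOp (crossBilin b hφ) (endWedge Θ s) = 0 := by
  constructor
  · intro h s
    have key : ∀ Ψ ∈ Submodule.span ℝ {Ψ : W → W → N → N | ∃ α ∈ lambda14 b φ,
        ∃ f : N →ₗ[ℝ] N, Ψ = fun u v n => α ![u, v] • f n}, ∀ u v w n,
        Ψ (cross b φ u v) w n - Ψ (cross b φ u w) v n + Ψ (cross b φ v w) u n = 0 := by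
      intro Ψ hΨ u v w n
      induction hΨ using Submodule.span_induction with
      | mem Ψ h =>
        obtain ⟨α, hα, f, rfl⟩ := h
        have := derivationOp_two_apply b hφ α u v w
        rw [(mem_lambda14_iff b hφ α).1 hα, AlternatingMap.zero_apply] at this
        rw [← sub_smul, ← add_smul, ← this, zero_smul]
      | zero => simp
      | add x y _ _ hx hy =>
        simp only [Pi.add_apply]
        calc _ = (x (cross b φ u v) w n - x (cross b φ u w) v n + x (cross b φ v w) u n) +
            (y (cross b φ u v) w n - y (cross b φ u w) v n + y (cross b φ v w) u n) := by abel
          _ = 0 := by rw [hx, hy, add_zero]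
      | smul r x _ hx =>
        simp only [Pi.smul_apply, ← smul_sub, ← smul_add, hx, smul_zero]
    ext x
    have hx : x = ![x 0, x 1, x 2] := by ext i; fin_cases i <;> rfl
    rw [hx, derivationOp_two_apply]
    simp only [endWedge_zero_apply Θ hΘ]
    exact key _ h _ _ _ _
  · intro h
    -- Expand `Θ` in matrix units of `End N`; each coefficient lies in `Λ²₁₄`.
    let m := Module.finBasis ℝ N
    let η (i : Fin (Module.finrank ℝ N)) : W [⋀^Fin 2]→ₗ[ℝ] N :=
      endWedge Θ (AlternatingMap.constOfIsEmpty ℝ W (Fin 0) (m i))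
    have hη : ∀ i u v, η i ![u, v] = Θ u v (m i) := fun i u v => endWedge_zero_apply Θ hΘ _ u v
    have hexp : (fun u v n => Θ u v n) = ∑ i, ∑ j, fun u v n =>
        ((m.coord j).compAlternatingMap (η i)) ![u, v] • ((m.coord i).smulRight (m j)) n := by
      ext u v n
      simp only [Finset.sum_apply, LinearMap.compAlternatingMap_apply, hη]
      conv_lhs => rw [← m.sum_repr n, map_sum]
      refine Finset.sum_congr rfl fun i _ => ?_
      rw [map_smul]
      conv_lhs => rw [← m.sum_repr (Θ u v (m i))]
      rw [Finset.smul_sum]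
      refine Finset.sum_congr rfl fun j _ => ?_
      simp [smul_smul, mul_comm]
    rw [hexp]
    refine Submodule.sum_mem _ fun i _ => Submodule.sum_mem _ fun j _ => Submodule.subset_span ?_
    refine ⟨_, (mem_lambda14_iff b hφ _).2 ?_, _, rfl⟩
    rw [derivationOp_compAlternatingMap, h]
    simp

end EndValued

/-! ### Extensions of vectors by the local trivialization -/

section Extension

open FiberBundle

variable {M : Type*} [TopologicalSpace M]
variable (F : Type*) [NormedAddCommGroup F] [NormedSpace ℝ F]
  {B : M → Type*} [TopologicalSpace (TotalSpace F B)]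
  [∀ x, AddCommGroup (B x)] [∀ x, Module ℝ (B x)] [∀ x, TopologicalSpace (B x)]
  [FiberBundle F B] [VectorBundle ℝ F B]

/-- The linear map `B x → B y` given by the preferred trivialization at `x`. It is `extend F · y`
for `y` in the base set of that trivialization; `extend` has arbitrary values elsewhere. -/
def transport (x y : M) : B x →ₗ[ℝ] B y :=
  (trivializationAt F B x).symmₗ ℝ y ∘ₗ (trivializationAt F B x).linearMapAt ℝ x

theorem extend_eq_transport {x y : M} (v : B x) (hy : y ∈ (trivializationAt F B x).baseSet) :
    extend F v y = transport F x y v := by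
  simp only [extend, transport, LinearMap.comp_apply]
  rw [Trivialization.coe_linearMapAt_of_mem _ (mem_baseSet_trivializationAt F B x),
    Trivialization.symmₗ_apply _ hy]

theorem contMDiffAt_extend_of_mem [ChartedSpace E7 M] [ContMDiffVectorBundle ∞ F B (𝓡 7)]
    {x y : M} (v : B x) (hy : y ∈ (trivializationAt F B x).baseSet) :
    ContMDiffAt (𝓡 7) ((𝓡 7).prod 𝓘(ℝ, F)) ∞
      (fun z => TotalSpace.mk' F z (extend F v z)) y := by
  have : ContMDiffOn (𝓡 7) ((𝓡 7).prod 𝓘(ℝ, F)) ∞ (fun z => TotalSpace.mk' F z (extend F v z))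
      (trivializationAt F B x).baseSet := by
    rw [Trivialization.contMDiffOn_section_baseSet_iff]
    refine (contMDiffOn_const (c := (trivializationAt F B x ⟨x, v⟩).2)).congr fun z hz => ?_
    rw [extend, Trivialization.apply_mk_symm _ hz]
  exact this.contMDiffAt ((trivializationAt F B x).open_baseSet.mem_nhds hy)

end Extension

section Frame

theorem isManifold_minSmoothness_three (M : Type*) [TopologicalSpace M] [ChartedSpace E7 M]
    [IsManifold (𝓡 7) ∞ M] : IsManifold (𝓡 7) (minSmoothness ℝ 3) M := by
  rw [minSmoothness_of_isRCLikeNormedField]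
  have h : ((3 : ℕ∞) : WithTop ℕ∞) ≤ ∞ := by exact_mod_cast le_top
  exact IsManifold.of_le (n := ∞) h

variable {M : Type*} [TopologicalSpace M] [ChartedSpace E7 M] [IsManifold (𝓡 7) ∞ M]

/-- The linear map that is `v ↦ ext v y` for `y` in the domain of the preferred chart at `x`. -/
def extLin (x y : M) : TangentSpace (𝓡 7) x →ₗ[ℝ] TangentSpace (𝓡 7) y :=
  transport E7 (B := fun x : M => TangentSpace (𝓡 7) x) x y

theorem ext_eq_extLin {x y : M} (v : TangentSpace (𝓡 7) x) (hy : y ∈ (chartAt E7 x).source) :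
    ext v y = extLin x y v :=
  extend_eq_transport E7 (B := fun x : M => TangentSpace (𝓡 7) x) v hy

@[simp]
theorem ext_self {x : M} (v : TangentSpace (𝓡 7) x) : ext v x = v :=
  FiberBundle.extend_apply_self ..

theorem smoothFieldAt_ext {x y : M} (v : TangentSpace (𝓡 7) x) (hy : y ∈ (chartAt E7 x).source) :
    SmoothFieldAt (ext v) y :=
  contMDiffAt_extend_of_mem E7 (B := fun x : M => TangentSpace (𝓡 7) x) v hy

/-- A constant vector field on the model space. -/
def constField (c : E7) (z : E7) : TangentSpace 𝓘(ℝ, E7) z := c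

/-- Extensions of two vectors at the same point are coordinate fields of one chart, so they
commute. -/
theorem mlieBracket_ext {x y : M} (u v : TangentSpace (𝓡 7) x) (hy : y ∈ (chartAt E7 x).source) :
    mlieBracket (𝓡 7) (ext u) (ext v) y = 0 := by
  have := isManifold_minSmoothness_three M
  set e := trivializationAt E7 (fun x : M => TangentSpace (𝓡 7) x) x with he
  -- Extensions are pullbacks of constant fields on the model space.
  have hpull : ∀ (w : TangentSpace (𝓡 7) x), ∀ z ∈ (chartAt E7 x).source, ext w z =
      mpullback (𝓡 7) 𝓘(ℝ, E7) (extChartAt (𝓡 7) x)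
        (constField (e ⟨x, w⟩).2) z := by
    intro w z hz
    have hinv := isInvertible_mfderiv_extChartAt (I := 𝓡 7) (x := x) (y := z)
      (by rwa [extChartAt_source])
    rw [mpullback_apply]
    symm
    rw [hinv.inverse_apply_eq, ← TangentBundle.continuousLinearMapAt_trivializationAt hz]
    have := (e.continuousLinearMapAt_symmL (R := ℝ) hz ((e ⟨x, w⟩).2)).symm
    rw [e.symmL_apply (R := ℝ) hz] at this
    exact this
  have hev : ∀ w : TangentSpace (𝓡 7) x, ext w =ᶠ[nhds y]
      mpullback (𝓡 7) 𝓘(ℝ, E7) (extChartAt (𝓡 7) x) (constField (e ⟨x, w⟩).2) := fun w =>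
    Filter.eventually_of_mem ((chartAt E7 x).open_source.mem_nhds hy) (hpull w)
  rw [Filter.EventuallyEq.mlieBracket_vectorField_eq (hev u) (hev v)]
  have h2 : ((2 : ℕ∞) : WithTop ℕ∞) ≤ ∞ := by exact_mod_cast le_top
  have hc : ∀ c z : E7, MDifferentiableAt 𝓘(ℝ, E7) (𝓘(ℝ, E7).prod 𝓘(ℝ, E7))
      (fun z => (TotalSpace.mk' E7 z (constField c z) : TangentBundle 𝓘(ℝ, E7) E7)) z := fun c z =>
    ((contMDiffAt_vectorSpace_iff_contDiffAt (n := 1)).2 contDiffAt_const).mdifferentiableAt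
      one_ne_zero
  rw [← mpullback_mlieBracket (n := ∞) (hc _ _) (hc _ _) (contMDiffAt_extChartAt' hy)
    (by rw [minSmoothness_of_isRCLikeNormedField]; exact h2)]
  have h0 : ∀ c d : E7, mlieBracket 𝓘(ℝ, E7) (constField c) (constField d) = 0 := fun c d => by
    rw [← mlieBracketWithin_univ, mlieBracketWithin_eq_lieBracketWithin]
    ext z
    change (fderivWithin ℝ (fun _ : E7 => d) Set.univ z c -
      fderivWithin ℝ (fun _ : E7 => c) Set.univ z d) _ = 0
    simp
  rw [h0]
  exact map_zero _

/-- The basis of the model space that corresponds to the basis at `x` in the trivialization. -/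
def modelBasis (x : M) : Module.Basis (Fin 7) ℝ E7 :=
  (chartBasis x).map ((trivializationAt E7 (fun x : M => TangentSpace (𝓡 7) x) x).linearEquivAt ℝ x
    (FiberBundle.mem_baseSet_trivializationAt' x))

/-- The coefficients of a tangent vector at `z` in the coordinate frame of the chart at `x`. -/
def frameCoeff (x : M) (a : Fin 7) (z : M) : TangentSpace (𝓡 7) z →ₗ[ℝ] ℝ :=
  (trivializationAt E7 (fun x : M => TangentSpace (𝓡 7) x) x).localFrameCoeff (𝓡 7)
    (modelBasis x) a z

theorem localFrame_eq_ext {x z : M} (hz : z ∈ (chartAt E7 x).source) (a : Fin 7) :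
    (trivializationAt E7 (fun x : M => TangentSpace (𝓡 7) x) x).localFrame (modelBasis x) a z =
      ext (chartBasis x a) z := by
  rw [Trivialization.localFrame_apply_of_mem_baseSet _ _ hz, ext_eq_extLin _ hz]
  set e := trivializationAt E7 (fun x : M => TangentSpace (𝓡 7) x) x
  have h : ∀ (y : M) (hy : y ∈ e.baseSet) (w : TangentSpace (𝓡 7) y),
      e.linearEquivAt ℝ y hy w = e.linearMapAt ℝ y w := fun y hy w => by
    rw [e.linearMapAt_def_of_mem hy]
    rfl
  change (e.linearEquivAt ℝ z hz).symm (e.linearEquivAt ℝ x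
    (FiberBundle.mem_baseSet_trivializationAt' x) (chartBasis x a)) = _
  rw [LinearEquiv.symm_apply_eq]
  exact (h x _ _).trans ((e.linearMapAt_symmₗ (R := ℝ) hz _).symm.trans (h z hz _).symm)

theorem sum_frameCoeff {x z : M} (hz : z ∈ (chartAt E7 x).source) (w : TangentSpace (𝓡 7) z) :
    w = ∑ a, frameCoeff x a z w • ext (chartBasis x a) z := by
  have := (trivializationAt E7 (fun x : M => TangentSpace (𝓡 7) x) x).eq_sum_localFrameCoeff_smul
    (I := 𝓡 7) (b := modelBasis x) (s := ext w) hz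
  simp only [localFrame_eq_ext hz, ext_self] at this
  exact this

theorem contMDiffAt_frameCoeff {x z : M} (hz : z ∈ (chartAt E7 x).source) (a : Fin 7)
    {X : ∀ y : M, TangentSpace (𝓡 7) y} (hX : SmoothFieldAt X z) :
    ContMDiffAt (𝓡 7) 𝓘(ℝ, ℝ) ∞ (fun y => frameCoeff x a y (X y)) z :=
  contMDiffAt_localFrameCoeff (modelBasis x) hz hX a

end Frame

/-! ### Tensoriality of the exterior covariant derivative -/

section Sections

variable {M : Type*} [TopologicalSpace M] [ChartedSpace E7 M]
variable {F : Type*} [NormedAddCommGroup F] [NormedSpace ℝ F]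
  {B : M → Type*} [TopologicalSpace (TotalSpace F B)] [∀ x, TopologicalSpace (B x)]
  [FiberBundle F B]

/-- Differentiability at `y` of a function. -/
abbrev MDiffFunAt (f : M → ℝ) (y : M) : Prop := MDifferentiableAt (𝓡 7) 𝓘(ℝ, ℝ) f y

/-- Differentiability at `y` of a section of a vector bundle with model fibre `F`. -/
abbrev MDiffSecAt (F : Type*) [NormedAddCommGroup F] [NormedSpace ℝ F]
    {B : M → Type*} [TopologicalSpace (TotalSpace F B)] [∀ x, TopologicalSpace (B x)]
    [FiberBundle F B] (σ : ∀ z, B z) (y : M) : Prop :=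
  MDifferentiableAt (𝓡 7) ((𝓡 7).prod 𝓘(ℝ, F)) (fun z => TotalSpace.mk' F z (σ z)) y

/-- Smoothness at `y` of a section of a vector bundle with model fibre `F`. -/
abbrev SmoothSecAt (F : Type*) [NormedAddCommGroup F] [NormedSpace ℝ F]
    {B : M → Type*} [TopologicalSpace (TotalSpace F B)] [∀ x, TopologicalSpace (B x)]
    [FiberBundle F B] (σ : ∀ z, B z) (y : M) : Prop :=
  ContMDiffAt (𝓡 7) ((𝓡 7).prod 𝓘(ℝ, F)) ∞ (fun z => TotalSpace.mk' F z (σ z)) y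

theorem SmoothSecAt.mdiffAt {σ : ∀ z, B z} {y : M} (h : SmoothSecAt F σ y) : MDiffSecAt F σ y :=
  h.mdifferentiableAt (by simp)

theorem SmoothSecAt.congr {σ τ : ∀ z, B z} {y : M} (h : SmoothSecAt F σ y)
    (he : ∀ᶠ z in nhds y, τ z = σ z) : SmoothSecAt F τ y :=
  h.congr_of_eventuallyEq (he.mono fun z hz => by simp only [hz])

end Sections

section Forms

variable {M : Type*} [TopologicalSpace M] [ChartedSpace E7 M] [IsManifold (𝓡 7) ∞ M]
variable {F : Type*} [NormedAddCommGroup F] [NormedSpace ℝ F]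
  {B : M → Type*} [TopologicalSpace (TotalSpace F B)]
  [∀ x, AddCommGroup (B x)] [∀ x, Module ℝ (B x)] [∀ x, TopologicalSpace (B x)]
  [FiberBundle F B]

variable {k : ℕ} {s : Family B k}

/-- The alternating map given by a smooth form at a point. -/
def IsSmoothForm.form (hs : IsSmoothForm F s) (x : M) :
    TangentSpace (𝓡 7) x [⋀^Fin k]→ₗ[ℝ] B x := (hs.alternating x).choose

theorem IsSmoothForm.apply_eq (hs : IsSmoothForm F s) (x : M)
    (v : Fin k → TangentSpace (𝓡 7) x) : s x v = hs.form x v :=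
  (hs.alternating x).choose_spec v

theorem IsSmoothForm.mdiffAt (hs : IsSmoothForm F s) {y : M}
    {X : Fin k → ∀ z : M, TangentSpace (𝓡 7) z} (hX : ∀ j, SmoothFieldAt (X j) y) :
    MDiffSecAt F (fun z => s z fun j => X j z) y :=
  (hs.smooth y X hX).mdifferentiableAt (by simp)

theorem IsSmoothForm.update_sum (hs : IsSmoothForm F s) {ι : Type*} (S : Finset ι) (z : M)
    (v : Fin k → TangentSpace (𝓡 7) z) (l : Fin k) (c : ι → ℝ) (w : ι → TangentSpace (𝓡 7) z) :
    s z (Function.update v l (∑ a ∈ S, c a • w a)) =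
      ∑ a ∈ S, c a • s z (Function.update v l (w a)) := by
  simp only [hs.apply_eq]
  rw [AlternatingMap.map_update_sum]
  simp only [AlternatingMap.map_update_smul]

/-- The extensions of tangent vectors commute, so the bracket terms of the exterior covariant
derivative do not contribute. -/
theorem bracketTerms_eq_zero (hs : IsSmoothForm F s) (x : M)
    (v : Fin (k + 1) → TangentSpace (𝓡 7) x) : bracketTerms s x v = 0 := by
  cases k with
  | zero => rfl
  | succ k =>
    rw [bracketTerms, neg_eq_zero]
    refine Finset.sum_eq_zero fun i _ => Finset.sum_eq_zero fun j _ => ?_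
    rw [mlieBracket_ext _ _ (mem_chart_source E7 x), hs.apply_eq,
      (hs.form x).map_coord_zero 0 (by simp), smul_zero]

theorem extCov_apply [∀ x, IsTopologicalAddGroup (B x)]
    [∀ x, ContinuousSMul ℝ (B x)] (D : CovariantDerivative (𝓡 7) F B) (hs : IsSmoothForm F s)
    (x : M) (v : Fin (k + 1) → TangentSpace (𝓡 7) x) :
    extCov D s x v = ∑ i : Fin (k + 1), (-1 : ℝ) ^ (i : ℕ) •
      D (fun y => s y (i.removeNth fun j => ext (v j) y)) x (v i) := by
  rw [extCov, bracketTerms_eq_zero hs, add_zero]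

end Forms

section Calculus

variable {M : Type*} [TopologicalSpace M] [ChartedSpace E7 M]
variable {F : Type*} [NormedAddCommGroup F] [NormedSpace ℝ F]
  {B : M → Type*} [TopologicalSpace (TotalSpace F B)]
  [∀ x, AddCommGroup (B x)] [∀ x, Module ℝ (B x)] [∀ x, TopologicalSpace (B x)]
  [∀ x, IsTopologicalAddGroup (B x)] [∀ x, ContinuousSMul ℝ (B x)] [FiberBundle F B]

/-- The covariant derivative is local. -/
theorem cov_congr (D : CovariantDerivative (𝓡 7) F B) {σ τ : ∀ z, B z} {y : M}
    (hσ : MDiffSecAt F σ y) (h : ∀ᶠ z in nhds y, σ z = τ z) : D σ y = D τ y := by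
  refine D.isCovariantDerivativeOnUniv.congr_of_eventuallyEq hσ ?_ Filter.univ_mem h
  exact hσ.congr_of_eventuallyEq (h.mono fun z hz => by simp only [hz])

theorem eventually_mem_source (y : M) : ∀ᶠ z in nhds y, z ∈ (chartAt E7 y).source :=
  (chartAt E7 y).open_source.mem_nhds (mem_chart_source E7 y)

theorem update_field {k : ℕ} (X : Fin k → ∀ z : M, TangentSpace (𝓡 7) z) (l : Fin k)
    (Y : ∀ z : M, TangentSpace (𝓡 7) z) (z : M) :
    (fun j => Function.update X l Y j z) = Function.update (fun j => X j z) l (Y z) := by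
  ext1 j
  by_cases h : j = l
  · subst h; simp
  · simp [h]

variable [VectorBundle ℝ F B]

theorem cov_sum_smul (D : CovariantDerivative (𝓡 7) F B) {ι : Type*} (S : Finset ι) {y : M}
    {c : ι → M → ℝ} {σ : ι → ∀ z, B z} (hc : ∀ a, MDiffFunAt (c a) y)
    (hσ : ∀ a, MDiffSecAt F (σ a) y) (u : TangentSpace (𝓡 7) y) :
    D (fun z => ∑ a ∈ S, c a z • σ a z) y u =
      ∑ a ∈ S, (c a y • D (σ a) y u + mvfderiv (𝓡 7) (c a) y u • σ a y) := by
  classical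
  induction S using Finset.induction_on with
  | empty =>
    have : (fun z => ∑ a ∈ (∅ : Finset ι), c a z • σ a z) = (0 : ∀ z, B z) := by
      ext z; simp
    rw [this, CovariantDerivative.zero]
    simp
  | insert a S ha ih =>
    have : (fun z => ∑ a ∈ insert a S, c a z • σ a z) =
        (c a • σ a) + fun z => ∑ a ∈ S, c a z • σ a z := by
      ext z; simp [Finset.sum_insert ha]
    have hS : MDiffSecAt F (fun z => ∑ a ∈ S, c a z • σ a z) y :=
      .sum_section fun a _ => (hc a).smul_section (hσ a)
    rw [this, D.isCovariantDerivativeOnUniv.add ((hc a).smul_section (hσ a)) hS,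
      D.isCovariantDerivativeOnUniv.leibniz (hσ a) (hc a), Finset.sum_insert ha,
      add_apply, ih]
    rfl

theorem cov_sum_const_smul (D : CovariantDerivative (𝓡 7) F B) {ι : Type*} (S : Finset ι) {y : M}
    {c : ι → ℝ} {σ : ι → ∀ z, B z} (hσ : ∀ a, MDiffSecAt F (σ a) y) (u : TangentSpace (𝓡 7) y) :
    D (fun z => ∑ a ∈ S, c a • σ a z) y u = ∑ a ∈ S, c a • D (σ a) y u := by
  rw [cov_sum_smul D S (c := fun a _ => c a) (fun a => mdifferentiableAt_const) hσ u]
  simp [mvfderiv]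

variable [IsManifold (𝓡 7) ∞ M]

/-- The derivative at `y` of a vector field along `u` for the flat connection of the chart
at `y`. -/
def flatDeriv (y : M) (X : ∀ z : M, TangentSpace (𝓡 7) z) (u : TangentSpace (𝓡 7) y) :
    TangentSpace (𝓡 7) y :=
  ∑ a, mvfderiv (𝓡 7) (fun z => frameCoeff y a z (X z)) y u • chartBasis y a

theorem SmoothFieldAt.mdiffAt {X : ∀ z : M, TangentSpace (𝓡 7) z} {y : M}
    (hX : SmoothFieldAt X y) : MDiffSecAt E7 X y :=
  ContMDiffAt.mdifferentiableAt hX (by simp)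

theorem mdiffAt_frameCoeff {x z : M} (hz : z ∈ (chartAt E7 x).source) (a : Fin 7)
    {X : ∀ y : M, TangentSpace (𝓡 7) y} (hX : SmoothFieldAt X z) :
    MDiffFunAt (fun y => frameCoeff x a y (X y)) z :=
  (contMDiffAt_frameCoeff hz a hX).mdifferentiableAt (by simp)

theorem mlieBracket_sum_left {ι : Type*} (S : Finset ι) {y : M} {c : ι → M → ℝ}
    {Y : ι → ∀ z : M, TangentSpace (𝓡 7) z} (hc : ∀ a, MDiffFunAt (c a) y)
    (hY : ∀ a, MDiffSecAt E7 (Y a) y) (Z : ∀ z : M, TangentSpace (𝓡 7) z) :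
    mlieBracket (𝓡 7) (fun z => ∑ a ∈ S, c a z • Y a z) Z y =
      ∑ a ∈ S, (c a y • mlieBracket (𝓡 7) (Y a) Z y - mvfderiv (𝓡 7) (c a) y (Z y) • Y a y) := by
  classical
  induction S using Finset.induction_on with
  | empty =>
    have : (fun z => ∑ a ∈ (∅ : Finset ι), c a z • Y a z) =
        (0 : ∀ z : M, TangentSpace (𝓡 7) z) := by
      ext1 z; simp
    rw [this, mlieBracket_zero_left]
    simp
  | insert a S ha ih =>
    have : (fun z => ∑ a ∈ insert a S, c a z • Y a z) =
        (c a • Y a) + fun z => ∑ a ∈ S, c a z • Y a z := by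
      ext1 z; simp [Finset.sum_insert ha]
    have hS : MDiffSecAt E7 (fun z => ∑ a ∈ S, c a z • Y a z) y :=
      .sum_section fun a _ => (hc a).smul_section (hY a)
    rw [this, mlieBracket_add_left ((hc a).smul_section (hY a)) hS,
      mlieBracket_smul_left (hc a) (hY a), Finset.sum_insert ha, ih]
    module

/-- The flat connection of a chart is torsion free. -/
theorem flatDeriv_sub_flatDeriv {y : M} {X Z : ∀ z : M, TangentSpace (𝓡 7) z}
    (hX : SmoothFieldAt X y) (hZ : SmoothFieldAt Z y) :
    flatDeriv y Z (X y) - flatDeriv y X (Z y) = mlieBracket (𝓡 7) X Z y := by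
  have hy := mem_chart_source E7 y
  have hexp : ∀ W : ∀ z : M, TangentSpace (𝓡 7) z, W =ᶠ[nhds y]
      fun z => ∑ a, frameCoeff y a z (W z) • ext (chartBasis y a) z := fun W =>
    (eventually_mem_source y).mono fun z hz => sum_frameCoeff hz (W z)
  have hext : ∀ a, MDiffSecAt E7 (ext (chartBasis y a)) y := fun a =>
    (smoothFieldAt_ext (chartBasis y a) hy).mdiffAt
  have hleft : ∀ {W V : ∀ z : M, TangentSpace (𝓡 7) z}, SmoothFieldAt W y →
      mlieBracket (𝓡 7) W V y = ∑ a, (frameCoeff y a y (W y) •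
        mlieBracket (𝓡 7) (ext (chartBasis y a)) V y -
          mvfderiv (𝓡 7) (fun z => frameCoeff y a z (W z)) y (V y) • chartBasis y a) := by
    intro W V hW
    rw [Filter.EventuallyEq.mlieBracket_vectorField_eq (hexp W) (Filter.EventuallyEq.refl _ V)]
    refine (mlieBracket_sum_left _ (fun a => mdiffAt_frameCoeff hy a hW) hext V).trans ?_
    simp only [ext_self]
  have hframe : ∀ a, mlieBracket (𝓡 7) (ext (chartBasis y a)) Z y =
      ∑ b, mvfderiv (𝓡 7) (fun z => frameCoeff y b z (Z z)) y (chartBasis y a) •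
        chartBasis y b := fun a => by
    rw [mlieBracket_swap_apply, hleft hZ]
    simp [mlieBracket_ext _ _ hy]
  rw [hleft hX, Finset.sum_sub_distrib]
  simp only [hframe, flatDeriv]
  congr 1
  have hx : X y = ∑ a, frameCoeff y a y (X y) • chartBasis y a := by
    conv_lhs => rw [sum_frameCoeff hy (X y)]
    simp only [ext_self]
  conv_lhs => rw [hx]
  simp only [map_sum, map_smul, Finset.sum_smul, Finset.smul_sum, smul_assoc]
  rw [Finset.sum_comm]

variable {k : ℕ} {s : Family B k}

theorem smoothFieldAt_update {y : M} {X : Fin k → ∀ z : M, TangentSpace (𝓡 7) z}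
    (hX : ∀ j, SmoothFieldAt (X j) y) (l : Fin k) {Y : ∀ z : M, TangentSpace (𝓡 7) z}
    (hY : SmoothFieldAt Y y) (j : Fin k) : SmoothFieldAt (Function.update X l Y j) y := by
  by_cases h : j = l
  · subst h; simpa using hY
  · simpa [h] using hX j

/-- Replacing one field in `s(X₁, …, X_k)` by the extension of its value at `y` changes the
covariant derivative at `y` by the flat derivative of that field. -/
theorem cov_replace_slot (D : CovariantDerivative (𝓡 7) F B) (hs : IsSmoothForm F s) {y : M}
    {X : Fin k → ∀ z : M, TangentSpace (𝓡 7) z} (hX : ∀ j, SmoothFieldAt (X j) y) (l : Fin k)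
    (u : TangentSpace (𝓡 7) y) :
    D (fun z => s z fun j => X j z) y u =
      D (fun z => s z fun j => Function.update X l (ext (X l y)) j z) y u +
        s y (Function.update (fun j => X j y) l (flatDeriv y (X l) u)) := by
  have hy := mem_chart_source E7 y
  let σ (a : Fin 7) (z : M) : B z := s z fun j => Function.update X l (ext (chartBasis y a)) j z
  have hσ : ∀ a, MDiffSecAt F (σ a) y := fun a =>
    hs.mdiffAt (smoothFieldAt_update hX l (smoothFieldAt_ext _ hy))
  have h1 : D (fun z => s z fun j => X j z) y =
      D (fun z => ∑ a, frameCoeff y a z (X l z) • σ a z) y := by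
    refine cov_congr D (hs.mdiffAt hX) ((eventually_mem_source y).mono fun z hz => ?_)
    have : (fun j => X j z) = Function.update (fun j => X j z) l
        (∑ a, frameCoeff y a z (X l z) • ext (chartBasis y a) z) := by
      rw [← sum_frameCoeff hz (X l z), Function.update_eq_self_iff.2 rfl]
    conv_lhs => rw [this]
    rw [hs.update_sum]
    simp only [σ, update_field]
  have h2 : D (fun z => s z fun j => Function.update X l (ext (X l y)) j z) y =
      D (fun z => ∑ a, frameCoeff y a y (X l y) • σ a z) y := by
    refine cov_congr D (hs.mdiffAt (smoothFieldAt_update hX l (smoothFieldAt_ext _ hy)))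
      ((eventually_mem_source y).mono fun z hz => ?_)
    have : ext (X l y) z = ∑ a, frameCoeff y a y (X l y) • ext (chartBasis y a) z := by
      conv_lhs => rw [sum_frameCoeff hy (X l y)]
      simp only [ext_self, ext_eq_extLin _ hz, map_sum, map_smul]
    simp only [σ, update_field]
    rw [this, hs.update_sum]
  rw [h1, h2, cov_sum_smul D _ (fun a => mdiffAt_frameCoeff hy a (hX l)) hσ,
    cov_sum_const_smul D _ hσ, Finset.sum_add_distrib, flatDeriv, hs.update_sum]
  simp only [σ, update_field, ext_self]

/-- The covariant derivative of `s(X₁, …, X_k)`, compared with the one for the extensions of the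
values of the fields at `y`. -/
theorem cov_replace_all (D : CovariantDerivative (𝓡 7) F B) (hs : IsSmoothForm F s) {y : M}
    {X : Fin k → ∀ z : M, TangentSpace (𝓡 7) z} (hX : ∀ j, SmoothFieldAt (X j) y)
    (u : TangentSpace (𝓡 7) y) :
    D (fun z => s z fun j => X j z) y u =
      D (fun z => s z fun j => ext (X j y) z) y u +
        ∑ l, s y (Function.update (fun j => X j y) l (flatDeriv y (X l) u)) := by
  classical
  have hy := mem_chart_source E7 y
  let XS (S : Finset (Fin k)) (j : Fin k) : ∀ z : M, TangentSpace (𝓡 7) z :=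
    if j ∈ S then ext (X j y) else X j
  have hXS : ∀ S j, SmoothFieldAt (XS S j) y := fun S j => by
    simp only [XS]
    split_ifs
    · exact smoothFieldAt_ext _ hy
    · exact hX j
  have hval : ∀ S j, XS S j y = X j y := fun S j => by
    simp only [XS]
    split_ifs <;> simp
  have key : ∀ S : Finset (Fin k), D (fun z => s z fun j => X j z) y u =
      D (fun z => s z fun j => XS S j z) y u +
        ∑ l ∈ S, s y (Function.update (fun j => X j y) l (flatDeriv y (X l) u)) := by
    intro S
    induction S using Finset.induction_on with
    | empty => simp [XS]
    | insert l S hl ih =>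
      have hupd : Function.update (XS S) l (ext (XS S l y)) = XS (insert l S) := by
        ext1 j
        by_cases h : j = l
        · subst h
          simp [hval, XS]
        · simp [h, XS]
      have hl' : XS S l = X l := by simp [XS, hl]
      rw [ih, cov_replace_slot D hs (hXS S) l u, hupd, Finset.sum_insert hl, hl']
      simp only [hval]
      abel
  have := key Finset.univ
  simpa [XS] using this

/-- A double alternating sum of terms that are symmetric in the two distinguished indices
vanishes. -/
theorem sum_sum_removeNth_eq_zero {V N : Type*} [AddCommGroup N] [Module ℝ N] {n : ℕ}
    (G : Fin (n + 2) → Fin (n + 2) → (Fin n → V) → N) (hG : ∀ i j, G i j = G j i)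
    (v : Fin (n + 2) → V) :
    ∑ i : Fin (n + 2), (-1 : ℝ) ^ (i : ℕ) • ∑ j : Fin (n + 1), (-1 : ℝ) ^ (j : ℕ) •
      G i (i.succAbove j) (j.removeNth (i.removeNth v)) = 0 := by
  simp only [Finset.smul_sum]
  rw [Fin.sum_sum_eq_sum_triangle_add]
  refine Finset.sum_eq_zero fun i _ => Finset.sum_eq_zero fun j hj => ?_
  rw [Finset.mem_Ici] at hj
  have H1 : i.castSucc.succAbove j = j.succ := by simp [Fin.succAbove_of_le_castSucc, hj]
  have H2 : j.predAbove i.castSucc = i := by simp [Fin.predAbove_of_le_castSucc, hj]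
  have H3 : j.succ.succAbove i = i.castSucc := by simp [Fin.succAbove_of_castSucc_lt, hj]
  rw [Fin.removeNth_removeNth_eq_swap v j i.castSucc, H1, H2, H3, hG j.succ i.castSucc,
    Fin.val_castSucc, Fin.val_succ, pow_succ]
  module

/-- The exterior covariant derivative can be computed with any commuting fields. -/
theorem extCov_apply_fields (D : CovariantDerivative (𝓡 7) F B) (hs : IsSmoothForm F s) {y : M}
    {X : Fin (k + 1) → ∀ z : M, TangentSpace (𝓡 7) z} (hX : ∀ j, SmoothFieldAt (X j) y)
    (hcomm : ∀ i j, mlieBracket (𝓡 7) (X i) (X j) y = 0) :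
    extCov D s y (fun j => X j y) = ∑ i : Fin (k + 1), (-1 : ℝ) ^ (i : ℕ) •
      D (fun z => s z (i.removeNth fun j => X j z)) y (X i y) := by
  have h : ∀ i : Fin (k + 1), D (fun z => s z (i.removeNth fun j => X j z)) y (X i y) =
      D (fun z => s z (i.removeNth fun j => ext (X j y) z)) y (X i y) +
        ∑ l, s y (Function.update (i.removeNth fun j => X j y) l
          (flatDeriv y (X (i.succAbove l)) (X i y))) := fun i =>
    cov_replace_all D hs (X := fun l => X (i.succAbove l)) (fun l => hX _) (X i y)
  rw [extCov_apply D hs]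
  simp only [h, smul_add, Finset.sum_add_distrib]
  rw [left_eq_add]
  cases k with
  | zero => simp
  | succ k =>
    have hsymm : ∀ i j, flatDeriv y (X j) (X i y) = flatDeriv y (X i) (X j y) := fun i j => by
      rw [← sub_eq_zero, flatDeriv_sub_flatDeriv (hX i) (hX j), hcomm]
    refine Eq.trans ?_ (sum_sum_removeNth_eq_zero
      (fun i j r => s y (Matrix.vecCons (flatDeriv y (X j) (X i y)) r))
      (fun i j => by rw [hsymm]) (fun j => X j y))
    refine Finset.sum_congr rfl fun i _ => congrArg _ (Finset.sum_congr rfl fun l _ => ?_)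
    rw [hs.apply_eq, hs.apply_eq, ← Fin.insertNth_removeNth, AlternatingMap.map_insertNth,
      neg_one_pow_int_smul]

end Calculus

/-! ### Smoothness of the exterior covariant derivative -/

section Sections

variable {M : Type*} [TopologicalSpace M] [ChartedSpace E7 M]
variable {F : Type*} [NormedAddCommGroup F] [NormedSpace ℝ F]
  {B : M → Type*} [TopologicalSpace (TotalSpace F B)]
  [∀ x, AddCommGroup (B x)] [∀ x, Module ℝ (B x)] [∀ x, TopologicalSpace (B x)]
  [FiberBundle F B]

/-- In the chart at `x`, the coefficients of a form are alternating maps on the tangent space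
at `x`. -/
theorem IsSmoothForm.apply_ext [IsManifold (𝓡 7) ∞ M] {k : ℕ} {s : Family B k}
    (hs : IsSmoothForm F s) {x z : M} (hz : z ∈ (chartAt E7 x).source)
    (w : Fin k → TangentSpace (𝓡 7) x) :
    (s z fun j => ext (w j) z) = (hs.form z).compLinearMap (extLin x z) w := by
  simp only [hs.apply_eq, ext_eq_extLin _ hz]
  rfl

theorem IsSmoothForm.smoothSecAt_ext [IsManifold (𝓡 7) ∞ M] {k : ℕ} {s : Family B k}
    (hs : IsSmoothForm F s) {x z : M} (hz : z ∈ (chartAt E7 x).source)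
    (w : Fin k → TangentSpace (𝓡 7) x) :
    SmoothSecAt F (fun z => s z fun j => ext (w j) z) z :=
  hs.smooth z (fun j => ext (w j)) fun _ => smoothFieldAt_ext _ hz

variable [VectorBundle ℝ F B]

/-- A section that is smooth near `y` agrees near `y` with a smooth section. -/
theorem exists_smooth_section [T2Space M] [IsManifold (𝓡 7) ∞ M] {σ : ∀ z, B z} {y : M}
    (hσ : ∀ᶠ z in nhds y, SmoothSecAt F σ z) :
    ∃ τ : ∀ z, B z, (∀ z, SmoothSecAt F τ z) ∧ ∀ᶠ z in nhds y, τ z = σ z := by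
  obtain ⟨U, hU, hUo, hyU⟩ := eventually_nhds_iff.1 hσ
  obtain ⟨f, -, hf⟩ := (SmoothBumpFunction.nhds_basis_tsupport (I := 𝓡 7) y).mem_iff.1
    (hUo.mem_nhds hyU)
  refine ⟨fun z => f z • σ z, ?_, ?_⟩
  · have : ContMDiff (𝓡 7) ((𝓡 7).prod 𝓘(ℝ, F)) ∞
        (fun z => TotalSpace.mk' F z ((⇑f • σ) z)) :=
      ContMDiffOn.smul_section_of_tsupport f.contMDiff.contMDiffOn hUo hf
        fun z hz => (hU z hz).contMDiffWithinAt
    exact fun z => this z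
  · filter_upwards [f.eventuallyEq_one] with z hz
    rw [hz, Pi.one_apply, one_smul]

theorem eventually_smoothSecAt_extend [ContMDiffVectorBundle ∞ F B (𝓡 7)] {x : M} (b : B x) :
    ∀ᶠ z in nhds x, SmoothSecAt F (FiberBundle.extend F b) z :=
  Filter.eventually_of_mem ((trivializationAt F B x).open_baseSet.mem_nhds
    (FiberBundle.mem_baseSet_trivializationAt' x)) fun _ hz => contMDiffAt_extend_of_mem F b hz

/-- Smoothness of a form can be tested on coordinate fields. -/
theorem isSmoothForm_of_frame [IsManifold (𝓡 7) ∞ M] {k : ℕ} {s : Family B k}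
    (halt : ∀ x, ∃ a : TangentSpace (𝓡 7) x [⋀^Fin k]→ₗ[ℝ] B x, ∀ v, s x v = a v)
    (h : ∀ (x : M) (r : Fin k → Fin 7),
      SmoothSecAt F (fun z => s z fun j => ext (chartBasis x (r j)) z) x) : IsSmoothForm F s := by
  refine ⟨halt, fun x X hX => ?_⟩
  have hsum : SmoothSecAt F (fun z => ∑ r : Fin k → Fin 7, (∏ j, frameCoeff x (r j) z (X j z)) •
      s z fun j => ext (chartBasis x (r j)) z) x :=
    .sum_section fun r _ => .smul_section
      (contMDiffAt_finsetProd fun j _ => contMDiffAt_frameCoeff (mem_chart_source E7 x) _ (hX j))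
      (h x r)
  refine SmoothSecAt.congr hsum ((eventually_mem_source x).mono fun z hz => ?_)
  obtain ⟨a, ha⟩ := halt z
  simp only [ha]
  have : (fun j => X j z) = fun j => ∑ b, frameCoeff x b z (X j z) • ext (chartBasis x b) z := by
    ext1 j
    exact sum_frameCoeff hz _
  rw [this]
  exact (a.toMultilinearMap.map_sum _).trans
    (Finset.sum_congr rfl fun r _ => a.toMultilinearMap.map_smul_univ _ _)

end Sections

section Smoothness

variable {M : Type*} [TopologicalSpace M] [ChartedSpace E7 M] [IsManifold (𝓡 7) ∞ M]
variable {F : Type*} [NormedAddCommGroup F] [NormedSpace ℝ F]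
  {B : M → Type*} [TopologicalSpace (TotalSpace F B)]
  [∀ x, AddCommGroup (B x)] [∀ x, Module ℝ (B x)] [∀ x, TopologicalSpace (B x)]
  [∀ x, IsTopologicalAddGroup (B x)] [∀ x, ContinuousSMul ℝ (B x)] [FiberBundle F B]
  [VectorBundle ℝ F B]

/-- The covariant derivative of a section that is smooth near `y`, along a smooth field, is smooth
at `y`. -/
theorem smoothSecAt_cov [T2Space M] [ContMDiffVectorBundle ∞ F B (𝓡 7)]
    (D : CovariantDerivative (𝓡 7) F B) [hD : D.ContMDiffCovariantDerivative ∞]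
    {σ : ∀ z, B z} {y : M} (hσ : ∀ᶠ z in nhds y, SmoothSecAt F σ z)
    {X : ∀ z : M, TangentSpace (𝓡 7) z} (hX : SmoothFieldAt X y) :
    SmoothSecAt F (fun z => D σ z (X z)) y := by
  obtain ⟨τ, hτ, he⟩ := exists_smooth_section hσ
  have h1 := (hD.contMDiff.contMDiff (σ := τ) fun z _ => (hτ z).contMDiffWithinAt).contMDiffAt
    (x := y) Filter.univ_mem
  have h2 : SmoothSecAt F (fun z => D τ z (X z)) y := ContMDiffAt.clm_bundle_apply h1 hX
  refine h2.congr ?_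
  filter_upwards [he.eventually_nhds] with z hz
  rw [cov_congr D (hτ z).mdiffAt hz]

variable {k : ℕ} {s : Family B k}

/-- The covariant derivative of the coefficients of `s` in the chart at `x`, as a 1-form at `x`
with values in the forms. -/
def IsSmoothForm.covForm (hs : IsSmoothForm F s) (D : CovariantDerivative (𝓡 7) F B) (x : M) :
    TangentSpace (𝓡 7) x →ₗ[ℝ] TangentSpace (𝓡 7) x [⋀^Fin k]→ₗ[ℝ] B x where
  toFun u :=
    { toFun w := D (fun z => s z fun j => ext (w j) z) x u
      map_update_add' w l p q := by
        have hdec : ‹DecidableEq (Fin k)› = instDecidableEqFin k := Subsingleton.elim _ _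
        subst hdec
        have hm (w : Fin k → TangentSpace (𝓡 7) x) :
            MDiffSecAt F (fun z => s z fun j => ext (w j) z) x :=
          (hs.smoothSecAt_ext (mem_chart_source E7 x) w).mdiffAt
        rw [← add_apply, ← D.isCovariantDerivativeOnUniv.add (hm _) (hm _)]
        congr 1
        refine cov_congr D (hm _) ((eventually_mem_source x).mono fun z hz => ?_)
        simp only [Pi.add_apply, hs.apply_ext hz, AlternatingMap.map_update_add]
      map_update_smul' w l c p := by
        have hdec : ‹DecidableEq (Fin k)› = instDecidableEqFin k := Subsingleton.elim _ _
        subst hdec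
        have hm (w : Fin k → TangentSpace (𝓡 7) x) :
            MDiffSecAt F (fun z => s z fun j => ext (w j) z) x :=
          (hs.smoothSecAt_ext (mem_chart_source E7 x) w).mdiffAt
        rw [← smul_apply, ← D.isCovariantDerivativeOnUniv.smul_const c (hm _)]
        congr 1
        refine cov_congr D (hm _) ((eventually_mem_source x).mono fun z hz => ?_)
        simp only [Pi.smul_apply, hs.apply_ext hz, AlternatingMap.map_update_smul]
      map_eq_zero_of_eq' w i j hij hne := by
        have h : D (fun z => s z fun j => ext (w j) z) x = D (0 : ∀ z, B z) x := by
          refine cov_congr D (hs.smoothSecAt_ext (mem_chart_source E7 x) w).mdiffAt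
            ((eventually_mem_source x).mono fun z hz => ?_)
          rw [hs.apply_ext hz]
          exact AlternatingMap.map_eq_zero_of_eq _ w hij hne
        rw [h, CovariantDerivative.zero]
        rfl }
  map_add' u u' := by ext w; exact (D (fun z => s z fun j => ext (w j) z) x).map_add u u'
  map_smul' c u := by ext w; exact (D (fun z => s z fun j => ext (w j) z) x).map_smul c u

theorem IsSmoothForm.covForm_apply (hs : IsSmoothForm F s) (D : CovariantDerivative (𝓡 7) F B)
    (x : M) (u : TangentSpace (𝓡 7) x) (w : Fin k → TangentSpace (𝓡 7) x) :
    hs.covForm D x u w = D (fun z => s z fun j => ext (w j) z) x u := rfl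

theorem extCov_eq_alternatize (D : CovariantDerivative (𝓡 7) F B) (hs : IsSmoothForm F s) (x : M)
    (v : Fin (k + 1) → TangentSpace (𝓡 7) x) :
    extCov D s x v = AlternatingMap.alternatizeUncurryFin (hs.covForm D x) v := by
  rw [extCov_apply D hs, AlternatingMap.alternatizeUncurryFin_apply]
  simp only [neg_one_pow_int_smul, hs.covForm_apply]
  rfl

theorem extCov_apply_ext (D : CovariantDerivative (𝓡 7) F B) (hs : IsSmoothForm F s) {x z : M}
    (hz : z ∈ (chartAt E7 x).source) (v : Fin (k + 1) → TangentSpace (𝓡 7) x) :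
    (extCov D s z fun j => ext (v j) z) = ∑ i : Fin (k + 1), (-1 : ℝ) ^ (i : ℕ) •
      D (fun z => s z fun j => ext (i.removeNth v j) z) z (ext (v i) z) :=
  extCov_apply_fields D hs (X := fun j => ext (v j)) (fun _ => smoothFieldAt_ext _ hz)
    fun _ _ => mlieBracket_ext _ _ hz

theorem IsSmoothForm.extCov [T2Space M] [ContMDiffVectorBundle ∞ F B (𝓡 7)]
    (D : CovariantDerivative (𝓡 7) F B) [D.ContMDiffCovariantDerivative ∞]
    (hs : IsSmoothForm F s) : IsSmoothForm F (extCov D s) := by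
  refine isSmoothForm_of_frame (fun x => ⟨_, extCov_eq_alternatize D hs x⟩) fun x r => ?_
  have hsum : SmoothSecAt F (fun z => ∑ i : Fin (k + 1), (-1 : ℝ) ^ (i : ℕ) •
      D (fun z => s z fun j => ext (i.removeNth (fun j => chartBasis x (r j)) j) z) z
        (ext (chartBasis x (r i)) z)) x :=
    .sum_section fun i _ => .const_smul_section <| smoothSecAt_cov D
      ((eventually_mem_source x).mono fun z hz => hs.smoothSecAt_ext hz _)
      (smoothFieldAt_ext _ (mem_chart_source E7 x))
  exact hsum.congr ((eventually_mem_source x).mono fun z hz =>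
    extCov_apply_ext D hs hz fun j => chartBasis x (r j))

end Smoothness

/-! ### Smoothness of the structure operator -/

theorem contDiffAt_ninthRoot {t : ℝ} (ht : t ≠ 0) : ContDiffAt ℝ ∞ ninthRoot t := by
  have h : ninthRoot =ᶠ[nhds t] fun r =>
      ((SignType.sign t : SignType) : ℝ) * |r| ^ (1 / 9 : ℝ) := by
    filter_upwards [(continuousAt_sign_of_ne_zero ht).eventually_mem
      ((isOpen_discrete {SignType.sign t}).mem_nhds rfl)] with r hr
    rw [ninthRoot, Set.mem_singleton_iff.1 hr]
  refine ContDiffAt.congr_of_eventuallyEq ?_ h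
  exact contDiffAt_const.mul ((contDiffAt_abs ht).rpow_const_of_ne (abs_ne_zero.2 ht))

section StructureOperator

variable {M : Type*} [TopologicalSpace M] [ChartedSpace E7 M]

/-- Smoothness at `y` of a real function. -/
abbrev SmoothFunAt (f : M → ℝ) (y : M) : Prop := ContMDiffAt (𝓡 7) 𝓘(ℝ, ℝ) ∞ f y

theorem smoothFunAt_det {n : ℕ} {A : M → Matrix (Fin n) (Fin n) ℝ} {y : M}
    (hA : ∀ i j, SmoothFunAt (fun z => A z i j) y) : SmoothFunAt (fun z => (A z).det) y := by
  simp only [Matrix.det_apply']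
  exact .sum fun σ _ => contMDiffAt_const.mul (contMDiffAt_finsetProd fun i _ => hA _ _)

variable [IsManifold (𝓡 7) ∞ M]

/-- The basis of the tangent space at `z` that consists of the coordinate fields of the chart
at `x`. -/
def frameBasis (x : M) {z : M} (hz : z ∈ (chartAt E7 x).source) :
    Module.Basis (Fin 7) ℝ (TangentSpace (𝓡 7) z) :=
  (trivializationAt E7 (fun x : M => TangentSpace (𝓡 7) x) x).basisAt (modelBasis x) hz

theorem frameBasis_apply {x z : M} (hz : z ∈ (chartAt E7 x).source) (a : Fin 7) :
    frameBasis x hz a = ext (chartBasis x a) z := by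
  rw [← localFrame_eq_ext hz, Trivialization.localFrame_apply_of_mem_baseSet _ _ hz]
  rfl

variable {φ : ∀ x : M, TangentSpace (𝓡 7) x [⋀^Fin 3]→ₗ[ℝ] ℝ}

/-- The value of `volForm` in the coordinate frame of the chart at `x`. -/
def frameVol (φ : ∀ x : M, TangentSpace (𝓡 7) x [⋀^Fin 3]→ₗ[ℝ] ℝ) (x z : M)
    (u v : TangentSpace (𝓡 7) z) : ℝ :=
  let b (a : Fin 7) := ext (chartBasis x a) z
  (1 / 6) * ((1 / 24) * ∑ σ : Equiv.Perm (Fin 7), ((Equiv.Perm.sign σ : ℤ) : ℝ) *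
    (φ z ![u, b (σ 0), b (σ 1)] * φ z ![v, b (σ 2), b (σ 3)] * φ z ![b (σ 4), b (σ 5), b (σ 6)]))

theorem volForm_frameBasis {x z : M} (hz : z ∈ (chartAt E7 x).source) :
    volForm (frameBasis x hz) (φ z) = frameVol φ x z := by
  ext u v
  simp only [volForm, frameBasis_apply]
  rfl

theorem IsSmoothThreeForm.smoothFunAt (hφ : IsSmoothThreeForm φ) {y : M}
    {U V X : ∀ z : M, TangentSpace (𝓡 7) z} (hU : SmoothFieldAt U y) (hV : SmoothFieldAt V y)
    (hX : SmoothFieldAt X y) : SmoothFunAt (fun z => φ z ![U z, V z, X z]) y := by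
  have := hφ y ![U, V, X] (fun i => by fin_cases i <;> assumption)
  exact this.congr_of_eventuallyEq (.of_forall fun z =>
    congrArg (φ z) (funext fun i => by fin_cases i <;> rfl))

theorem smoothFunAt_frameVol (hφ : IsSmoothThreeForm φ) {x y : M} (hy : y ∈ (chartAt E7 x).source)
    {U V : ∀ z : M, TangentSpace (𝓡 7) z} (hU : SmoothFieldAt U y) (hV : SmoothFieldAt V y) :
    SmoothFunAt (fun z => frameVol φ x z (U z) (V z)) y := by
  have he (a : Fin 7) : SmoothFieldAt (ext (chartBasis x a)) y := smoothFieldAt_ext _ hy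
  exact contMDiffAt_const.mul (contMDiffAt_const.mul (.sum fun σ _ => contMDiffAt_const.mul
    (((hφ.smoothFunAt hU (he _) (he _)).mul (hφ.smoothFunAt hV (he _) (he _))).mul
      (hφ.smoothFunAt (he _) (he _) (he _)))))

/-- The cross product of smooth vector fields is smooth. -/
theorem IsG2.smoothFieldAt_cross (hφ : IsG2 φ) {x : M} {U V : ∀ z : M, TangentSpace (𝓡 7) z}
    (hU : SmoothFieldAt U x) (hV : SmoothFieldAt V x) :
    SmoothFieldAt (fun z => cross (chartBasis z) (φ z) (U z) (V z)) x := by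
  have hx := mem_chart_source E7 x
  have he (a : Fin 7) : SmoothFieldAt (ext (chartBasis x a)) x := smoothFieldAt_ext _ hx
  let A (z : M) : Matrix (Fin 7) (Fin 7) ℝ :=
    .of fun b a => frameVol φ x z (ext (chartBasis x a) z) (ext (chartBasis x b) z)
  let ψ (z : M) (b : Fin 7) : ℝ := ninthRoot (A z).det * φ z ![U z, V z, ext (chartBasis x b) z]
  have hA : ∀ b a, SmoothFunAt (fun z => A z b a) x := fun b a =>
    smoothFunAt_frameVol hφ.smooth hx (he a) (he b)
  have hdet : ∀ z (hz : z ∈ (chartAt E7 x).source),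
      (A z).det = gramDet (frameBasis x hz) (φ z) := by
    intro z hz
    rw [gramDet, volForm_frameBasis, ← Matrix.det_transpose]
    simp only [frameBasis_apply]
    rfl
  have hdet0 : ∀ z ∈ (chartAt E7 x).source, (A z).det ≠ 0 := fun z hz => by
    rw [hdet z hz]
    exact gramDet_ne_zero _ (hφ.positive z)
  have hAdet := smoothFunAt_det hA
  have hroot : SmoothFunAt (fun z => ninthRoot (A z).det) x :=
    (contDiffAt_ninthRoot (hdet0 x hx)).contMDiffAt.comp x hAdet
  have hψ : ∀ b, SmoothFunAt (fun z => ψ z b) x := fun b =>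
    hroot.mul (hφ.smooth.smoothFunAt hU hV (he b))
  -- Cramer's rule expresses the coefficients of the cross product by smooth functions.
  let c (a : Fin 7) (z : M) : ℝ := (A z).det⁻¹ * ((A z).updateCol a (ψ z)).det
  have hc : ∀ a, SmoothFunAt (c a) x := fun a => by
    refine (hAdet.inv₀ (hdet0 x hx)).mul (smoothFunAt_det fun i j => ?_)
    by_cases h : j = a
    · subst h
      simpa using hψ i
    · simpa [h] using hA i j
  have hsum : SmoothSecAt E7 (fun z => ∑ a, c a z • ext (chartBasis x a) z) x :=
    .sum_section fun a _ => .smul_section (hc a) (he a)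
  refine SmoothSecAt.congr hsum ((eventually_mem_source x).mono fun z hz => ?_)
  set b := frameBasis x hz with hb
  set w := cross (chartBasis z) (φ z) (U z) (V z) with hw
  have hmul : (A z).mulVec (b.repr w) = ψ z := by
    ext i
    have h1 : volBilin b (φ z) w (b i) = ψ z i := by
      have := (hφ.positive z).metric_cross b (U z) (V z) (b i)
      rw [cross_change_basis b (chartBasis z), ← hw, metricBilin, LinearMap.smul_apply,
        LinearMap.smul_apply, smul_eq_mul, inv_mul_eq_iff_eq_mul₀
          (ninthRoot_ne_zero (gramDet_ne_zero b (hφ.positive z)))] at this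
      rw [this, ← hdet z hz, frameBasis_apply hz]
    rw [← h1]
    conv_rhs => rw [← b.sum_repr w]
    simp only [map_sum, LinearMap.sum_apply, map_smul, LinearMap.smul_apply, volBilin_apply,
      hb, volForm_frameBasis, frameBasis_apply, smul_eq_mul]
    rw [Matrix.mulVec, dotProduct]
    exact Finset.sum_congr rfl fun a _ => mul_comm (A z i a) _
  have hcoef : ∀ a, b.repr w a = c a z := fun a => by
    have h1 : (A z).cramer (ψ z) = (A z).det • ⇑(b.repr w) := by
      rw [← hmul, Matrix.cramer_eq_adjugate_mulVec, Matrix.mulVec_mulVec, Matrix.adjugate_mul,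
        Matrix.smul_mulVec, Matrix.one_mulVec]
    have h2 := congrFun h1 a
    rw [Matrix.cramer_apply, Pi.smul_apply, smul_eq_mul] at h2
    rw [eq_inv_mul_iff_mul_eq₀ (hdet0 z hz), h2]
  conv_lhs => rw [← b.sum_repr w]
  exact Finset.sum_congr rfl fun a _ => by rw [hcoef, hb, frameBasis_apply]

/-- The structure operator acts by the derivation given by the cross product. -/
theorem structureOp_eq_derivationOp {B : M → Type*} [∀ x, AddCommGroup (B x)]
    [∀ x, Module ℝ (B x)] (hφ : IsG2 φ) {k : ℕ} {s : Family B k} (x : M)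
    (a : TangentSpace (𝓡 7) x [⋀^Fin k]→ₗ[ℝ] B x) (ha : ∀ v, s x v = a v)
    (v : Fin (k + 1) → TangentSpace (𝓡 7) x) :
    structureOp φ s x v = derivationOp (crossBilin (chartBasis x) (hφ.positive x)) a v := by
  cases k with
  | zero => rfl
  | succ k =>
    rw [derivationOp_apply]
    simp only [structureOp, ha]

variable {F : Type*} [NormedAddCommGroup F] [NormedSpace ℝ F]
  {B : M → Type*} [TopologicalSpace (TotalSpace F B)]
  [∀ x, AddCommGroup (B x)] [∀ x, Module ℝ (B x)] [∀ x, TopologicalSpace (B x)]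
  [FiberBundle F B] [VectorBundle ℝ F B]

theorem IsSmoothForm.structureOp [ContMDiffVectorBundle ∞ F B (𝓡 7)] (hφ : IsG2 φ) {k : ℕ}
    {s : Family B k} (hs : IsSmoothForm F s) : IsSmoothForm F (structureOp φ s) := by
  refine isSmoothForm_of_frame (fun x => ⟨_, structureOp_eq_derivationOp hφ x _ (hs.apply_eq x)⟩)
    fun x r => ?_
  have he (a : Fin 7) : SmoothFieldAt (ext (chartBasis x a)) x :=
    smoothFieldAt_ext _ (mem_chart_source E7 x)
  cases k with
  | zero => exact contMDiff_zeroSection ℝ B x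
  | succ k =>
    have hsum : SmoothSecAt F (fun z => ∑ i : Fin (k + 1), ∑ j ≥ i,
        (-1 : ℝ) ^ ((i : ℕ) + (j : ℕ)) • s z fun l => (Fin.cons
          (fun z => cross (chartBasis z) (φ z) (ext (chartBasis x (r i.castSucc)) z)
            (ext (chartBasis x (r j.succ)) z))
          (j.removeNth (i.castSucc.removeNth fun j => ext (chartBasis x (r j)))) :
            Fin (k + 1) → ∀ z : M, TangentSpace (𝓡 7) z) l z) x := by
      refine .sum_section fun i _ => .sum_section fun j _ => .const_smul_section <| hs.smooth x _ ?_
      intro l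
      refine Fin.cases ?_ (fun l => ?_) l
      · exact hφ.smoothFieldAt_cross (he _) (he _)
      · exact he _
    refine hsum.congr (.of_forall fun z => ?_)
    refine Finset.sum_congr rfl fun i _ => Finset.sum_congr rfl fun j _ => ?_
    congr 2
    ext1 l
    refine Fin.cases ?_ (fun l => ?_) l <;> rfl

end StructureOperator

/-! ### Curvature and the square of the exterior covariant derivative -/

section FunctionDerivatives

variable {M : Type*} [TopologicalSpace M] [ChartedSpace E7 M] [IsManifold (𝓡 7) ∞ M]

theorem smoothFieldAt_mlieBracket {X Y : ∀ z : M, TangentSpace (𝓡 7) z} {y : M}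
    (hX : SmoothFieldAt X y) (hY : SmoothFieldAt Y y) :
    SmoothFieldAt (mlieBracket (𝓡 7) X Y) y := by
  have := isManifold_minSmoothness_three M
  have : IsManifold (𝓡 7) (((⊤ : ℕ∞) : WithTop ℕ∞) + 1) M := ‹IsManifold (𝓡 7) ∞ M›
  exact ContMDiffAt.mlieBracket_vectorField (m := ⊤) (n := ⊤) hX hY
    (by rw [minSmoothness_of_isRCLikeNormedField]; exact le_rfl)

theorem frameCoeff_ext_self {x z : M} (hz : z ∈ (chartAt E7 x).source) (a : Fin 7) :
    frameCoeff x a z (ext (chartBasis x a) z) = 1 := by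
  have h := sum_frameCoeff hz (ext (chartBasis x a) z)
  simp only [← frameBasis_apply hz] at h ⊢
  have h2 := congrArg ((frameBasis x hz).coord a) h
  simp only [map_sum, map_smul, Module.Basis.coord_apply, Module.Basis.repr_self,
    Finsupp.single_apply, smul_eq_mul, mul_ite, mul_one, mul_zero, Finset.sum_ite_eq',
    Finset.mem_univ, if_true] at h2
  exact h2.symm

/-- The bracket with a multiple of a commuting field computes the derivative of the factor. -/
theorem mlieBracket_smul_ext {x z : M} (hz : z ∈ (chartAt E7 x).source) {f : M → ℝ}
    (hf : MDiffFunAt f z) (v w : TangentSpace (𝓡 7) x) :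
    mlieBracket (𝓡 7) (ext v) (f • ext w) z = mvfderiv (𝓡 7) f z (ext v z) • ext w z := by
  rw [mlieBracket_smul_right hf (smoothFieldAt_ext w hz).mdiffAt, mlieBracket_ext v w hz, smul_zero,
    add_zero]

theorem smoothFunAt_mvfderiv {x : M} {f : M → ℝ} (hf : ∀ᶠ z in nhds x, SmoothFunAt f z)
    (v : TangentSpace (𝓡 7) x) :
    SmoothFunAt (fun z => mvfderiv (𝓡 7) f z (ext v z)) x := by
  have hx := mem_chart_source E7 x
  have h1 : SmoothFieldAt (f • ext (chartBasis x 0)) x :=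
    ContMDiffAt.smul_section hf.self_of_nhds (smoothFieldAt_ext _ hx)
  refine (contMDiffAt_frameCoeff hx 0 (smoothFieldAt_mlieBracket (smoothFieldAt_ext v hx)
    h1)).congr_of_eventuallyEq ?_
  filter_upwards [hf, eventually_mem_source x] with z hfz hz
  rw [mlieBracket_smul_ext hz (hfz.mdifferentiableAt (by simp)), map_smul, frameCoeff_ext_self hz,
    smul_eq_mul, mul_one]

/-- Derivatives of functions along extensions of two vectors commute. The proof applies the Jacobi
identity to two coordinate fields and a multiple of a third one. -/
theorem mvfderiv_comm {x : M} {f : M → ℝ} (hf : ∀ᶠ z in nhds x, SmoothFunAt f z)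
    (u v : TangentSpace (𝓡 7) x) :
    mvfderiv (𝓡 7) (fun z => mvfderiv (𝓡 7) f z (ext v z)) x u =
      mvfderiv (𝓡 7) (fun z => mvfderiv (𝓡 7) f z (ext u z)) x v := by
  have hx := mem_chart_source E7 x
  have := isManifold_minSmoothness_three M
  set w := chartBasis x 0
  have hfw : SmoothFieldAt (f • ext w) x :=
    ContMDiffAt.smul_section hf.self_of_nhds (smoothFieldAt_ext _ hx)
  have key : ∀ u v : TangentSpace (𝓡 7) x,
      mlieBracket (𝓡 7) (ext u) (mlieBracket (𝓡 7) (ext v) (f • ext w)) x =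
        mvfderiv (𝓡 7) (fun z => mvfderiv (𝓡 7) f z (ext v z)) x u • w := fun u v => by
    have hev : mlieBracket (𝓡 7) (ext v) (f • ext w) =ᶠ[nhds x]
        (fun z => mvfderiv (𝓡 7) f z (ext v z)) • ext w := by
      filter_upwards [hf, eventually_mem_source x] with z hfz hz
      exact mlieBracket_smul_ext hz (hfz.mdifferentiableAt (by simp)) v w
    rw [Filter.EventuallyEq.mlieBracket_vectorField_eq (Filter.EventuallyEq.refl _ (ext u)) hev,
      mlieBracket_smul_ext hx ((smoothFunAt_mvfderiv hf v).mdifferentiableAt (by simp)),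
      ext_self, ext_self]
  have hle : (minSmoothness ℝ 2 : WithTop ℕ∞) ≤ ∞ := by
    rw [minSmoothness_of_isRCLikeNormedField]
    have h : ((2 : ℕ∞) : WithTop ℕ∞) ≤ ∞ := by exact_mod_cast le_top
    exact h
  have hJ := leibniz_identity_mlieBracket_apply (I := 𝓡 7) (x := x)
    (ContMDiffAt.of_le (smoothFieldAt_ext u hx) hle)
    (ContMDiffAt.of_le (smoothFieldAt_ext v hx) hle)
    (ContMDiffAt.of_le hfw hle)
  have h0 : mlieBracket (𝓡 7) (mlieBracket (𝓡 7) (ext u) (ext v)) (f • ext w) x = 0 := by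
    have : mlieBracket (𝓡 7) (ext u) (ext v) =ᶠ[nhds x]
        (0 : ∀ z : M, TangentSpace (𝓡 7) z) :=
      (eventually_mem_source x).mono fun z hz => mlieBracket_ext u v hz
    refine (Filter.EventuallyEq.mlieBracket_vectorField_eq this .rfl).trans ?_
    rw [mlieBracket_zero_left]
    rfl
  rw [h0, zero_add, key, key] at hJ
  exact smul_left_injective ℝ ((chartBasis x).ne_zero 0) hJ

end FunctionDerivatives

section Curvature

variable {M : Type*} [TopologicalSpace M] [ChartedSpace E7 M] [IsManifold (𝓡 7) ∞ M]
variable {F : Type*} [NormedAddCommGroup F] [NormedSpace ℝ F]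
  {B : M → Type*} [TopologicalSpace (TotalSpace F B)]
  [∀ x, AddCommGroup (B x)] [∀ x, Module ℝ (B x)] [∀ x, TopologicalSpace (B x)]
  [∀ x, IsTopologicalAddGroup (B x)] [∀ x, ContinuousSMul ℝ (B x)] [FiberBundle F B]
  (D : CovariantDerivative (𝓡 7) F B)

/-- The second covariant derivative `∇_U ∇_V σ` at `x` for the extensions `U`, `V` of `u`, `v`. -/
def secondCov (σ : ∀ z, B z) (x : M) (u v : TangentSpace (𝓡 7) x) : B x :=
  D (fun y => D σ y (ext v y)) x u

/-- The commutator of second covariant derivatives along the extensions of two vectors. -/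
def commCov (σ : ∀ z, B z) (x : M) (u v : TangentSpace (𝓡 7) x) : B x :=
  secondCov D σ x u v - secondCov D σ x v u

/-- Extensions of tangent vectors commute, so the curvature has no bracket term. -/
theorem curvature_eq_commCov (x : M) (u v : TangentSpace (𝓡 7) x) (b : B x) :
    curvature D x u v b = commCov D (FiberBundle.extend F b) x u v := by
  rw [curvature, mlieBracket_ext u v (mem_chart_source E7 x), map_zero, sub_zero]
  rfl

theorem commCov_swap (σ : ∀ z, B z) {x : M} (u v : TangentSpace (𝓡 7) x) :
    commCov D σ x v u = -commCov D σ x u v := (neg_sub _ _).symm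

variable [T2Space M] [VectorBundle ℝ F B] [ContMDiffVectorBundle ∞ F B (𝓡 7)]
  [D.ContMDiffCovariantDerivative ∞]
variable {x : M} {σ τ : ∀ z, B z}

theorem secondCov_congr (hσ : ∀ᶠ z in nhds x, SmoothSecAt F σ z) (h : ∀ᶠ z in nhds x, σ z = τ z)
    (u v : TangentSpace (𝓡 7) x) : secondCov D σ x u v = secondCov D τ x u v := by
  rw [secondCov, secondCov, cov_congr D (smoothSecAt_cov D hσ
    (smoothFieldAt_ext v (mem_chart_source E7 x))).mdiffAt]
  filter_upwards [hσ, h.eventually_nhds] with z hz hh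
  rw [cov_congr D hz.mdiffAt hh]

/-- The Leibniz rule for second covariant derivatives. -/
theorem secondCov_sum_smul {ι : Type*} [Fintype ι] {c : ι → M → ℝ} {τ : ι → ∀ z, B z}
    (hc : ∀ a, ∀ᶠ z in nhds x, SmoothFunAt (c a) z)
    (hτ : ∀ a, ∀ᶠ z in nhds x, SmoothSecAt F (τ a) z)
    (u v : TangentSpace (𝓡 7) x) :
    secondCov D (fun z => ∑ a, c a z • τ a z) x u v =
      ∑ a, (c a x • secondCov D (τ a) x u v + mvfderiv (𝓡 7) (c a) x u • D (τ a) x v +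
        (mvfderiv (𝓡 7) (c a) x v • D (τ a) x u +
          mvfderiv (𝓡 7) (fun z => mvfderiv (𝓡 7) (c a) z (ext v z)) x u • τ a x)) := by
  have hx := mem_chart_source E7 x
  have hcd : ∀ a, MDiffFunAt (c a) x := fun a =>
    (hc a).self_of_nhds.mdifferentiableAt (by simp)
  have hDτ : ∀ a, SmoothSecAt F (fun z => D (τ a) z (ext v z)) x := fun a =>
    smoothSecAt_cov D (hτ a) (smoothFieldAt_ext v hx)
  have hcv : ∀ a, MDiffFunAt (fun z => mvfderiv (𝓡 7) (c a) z (ext v z)) x := fun a =>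
    (smoothFunAt_mvfderiv (hc a) v).mdifferentiableAt (by simp)
  have hS : ∀ᶠ z in nhds x, SmoothSecAt F (fun z => ∑ a, c a z • τ a z) z := by
    filter_upwards [Filter.eventually_all.2 hc, Filter.eventually_all.2 hτ] with z h1 h2
    exact .sum_section fun a _ => .smul_section (h1 a) (h2 a)
  have hev : ∀ᶠ z in nhds x, D (fun z => ∑ a, c a z • τ a z) z (ext v z) =
      ((fun z => ∑ a, c a z • D (τ a) z (ext v z)) +
        fun z => ∑ a, mvfderiv (𝓡 7) (c a) z (ext v z) • τ a z : ∀ z, B z) z := by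
    filter_upwards [Filter.eventually_all.2 hc, Filter.eventually_all.2 hτ] with z h1 h2
    rw [cov_sum_smul D _ (fun a => (h1 a).mdifferentiableAt (by simp)) fun a => (h2 a).mdiffAt,
      Finset.sum_add_distrib]
    rfl
  have hA : MDiffSecAt F (fun z => ∑ a, c a z • D (τ a) z (ext v z)) x :=
    .sum_section fun a _ => (hcd a).smul_section (hDτ a).mdiffAt
  have hB : MDiffSecAt F (fun z => ∑ a, mvfderiv (𝓡 7) (c a) z (ext v z) • τ a z) x :=
    .sum_section fun a _ => (hcv a).smul_section (hτ a).self_of_nhds.mdiffAt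
  rw [secondCov, cov_congr D (smoothSecAt_cov D hS (smoothFieldAt_ext v hx)).mdiffAt hev,
    D.isCovariantDerivativeOnUniv.add hA hB, add_apply,
    cov_sum_smul D _ hcd (fun a => (hDτ a).mdiffAt),
    cov_sum_smul D _ hcv (fun a => (hτ a).self_of_nhds.mdiffAt), ← Finset.sum_add_distrib]
  simp only [ext_self]
  rfl

/-- The commutator of second covariant derivatives is linear over functions. -/
theorem commCov_sum_smul {ι : Type*} [Fintype ι] {c : ι → M → ℝ} {τ : ι → ∀ z, B z}
    (hc : ∀ a, ∀ᶠ z in nhds x, SmoothFunAt (c a) z)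
    (hτ : ∀ a, ∀ᶠ z in nhds x, SmoothSecAt F (τ a) z)
    (u v : TangentSpace (𝓡 7) x) :
    commCov D (fun z => ∑ a, c a z • τ a z) x u v = ∑ a, c a x • commCov D (τ a) x u v := by
  rw [commCov, secondCov_sum_smul D hc hτ, secondCov_sum_smul D hc hτ, ← Finset.sum_sub_distrib]
  refine Finset.sum_congr rfl fun a _ => ?_
  rw [mvfderiv_comm (hc a) v u, commCov]
  module

/-- The commutator of second covariant derivatives depends only on the value of the section. -/
theorem commCov_eq_of_eq [FiniteDimensional ℝ F] (hσ : ∀ᶠ z in nhds x, SmoothSecAt F σ z)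
    (hτ : ∀ᶠ z in nhds x, SmoothSecAt F τ z) (h : σ x = τ x) (u v : TangentSpace (𝓡 7) x) :
    commCov D σ x u v = commCov D τ x u v := by
  set e := trivializationAt F B x
  have hx : x ∈ e.baseSet := FiberBundle.mem_baseSet_trivializationAt' x
  have : ContMDiffVectorBundle 1 F B (𝓡 7) := ContMDiffVectorBundle.of_le (n := ∞) (by simp)
  -- Both sides are expanded in a local frame.
  let b := Module.finBasis ℝ F
  have hb : ∀ᶠ z in nhds x, z ∈ e.baseSet := e.open_baseSet.mem_nhds hx
  have key : ∀ ρ : ∀ z, B z, (∀ᶠ z in nhds x, SmoothSecAt F ρ z) → commCov D ρ x u v =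
      ∑ a, e.localFrameCoeff (𝓡 7) b a x (ρ x) • commCov D (e.localFrame b a) x u v := by
    intro ρ hρ
    have hexp : ∀ᶠ z in nhds x, ρ z =
        ∑ a, e.localFrameCoeff (𝓡 7) b a z (ρ z) • e.localFrame b a z :=
      hb.mono fun z hz => e.eq_sum_localFrameCoeff_smul (I := 𝓡 7) (b := b) (s := ρ) hz
    rw [commCov, secondCov_congr D hρ hexp, secondCov_congr D hρ hexp]
    refine commCov_sum_smul D
      (c := fun a z => e.localFrameCoeff (𝓡 7) b a z (ρ z)) (τ := e.localFrame b)
      (fun a => ?_) (fun a => ?_) u v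
    · filter_upwards [hb, hρ] with z hz hρz
      exact contMDiffAt_localFrameCoeff b hz hρz a
    · filter_upwards [hb] with z hz
      exact contMDiffAt_localFrame_of_mem ∞ e b a hz
  rw [key σ hσ, key τ hτ, h]

theorem secondCov_add_right (hσ : ∀ᶠ z in nhds x, SmoothSecAt F σ z)
    (u v w : TangentSpace (𝓡 7) x) :
    secondCov D σ x u (v + w) = secondCov D σ x u v + secondCov D σ x u w := by
  have hm (v : TangentSpace (𝓡 7) x) : MDiffSecAt F (fun z => D σ z (ext v z)) x :=
    (smoothSecAt_cov D hσ (smoothFieldAt_ext v (mem_chart_source E7 x))).mdiffAt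
  rw [secondCov, secondCov, secondCov, ← add_apply,
    ← D.isCovariantDerivativeOnUniv.add (hm _) (hm _)]
  congr 1
  refine cov_congr D (hm _) ((eventually_mem_source x).mono fun z hz => ?_)
  rw [ext_eq_extLin _ hz, map_add, map_add, Pi.add_apply, ext_eq_extLin _ hz, ext_eq_extLin _ hz]

theorem secondCov_smul_right (hσ : ∀ᶠ z in nhds x, SmoothSecAt F σ z) (c : ℝ)
    (u v : TangentSpace (𝓡 7) x) :
    secondCov D σ x u (c • v) = c • secondCov D σ x u v := by
  have hm (v : TangentSpace (𝓡 7) x) : MDiffSecAt F (fun z => D σ z (ext v z)) x :=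
    (smoothSecAt_cov D hσ (smoothFieldAt_ext v (mem_chart_source E7 x))).mdiffAt
  rw [secondCov, secondCov, ← smul_apply, ← D.isCovariantDerivativeOnUniv.smul_const c (hm _)]
  congr 1
  refine cov_congr D (hm _) ((eventually_mem_source x).mono fun z hz => ?_)
  rw [ext_eq_extLin _ hz, map_smul, map_smul, Pi.smul_apply, ext_eq_extLin _ hz]

theorem commCov_add_left (hσ : ∀ᶠ z in nhds x, SmoothSecAt F σ z)
    (u u' v : TangentSpace (𝓡 7) x) :
    commCov D σ x (u + u') v = commCov D σ x u v + commCov D σ x u' v := by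
  rw [commCov, secondCov_add_right D hσ, secondCov, map_add]
  exact add_sub_add_comm _ _ _ _

theorem commCov_smul_left (hσ : ∀ᶠ z in nhds x, SmoothSecAt F σ z) (c : ℝ)
    (u v : TangentSpace (𝓡 7) x) : commCov D σ x (c • u) v = c • commCov D σ x u v := by
  rw [commCov, secondCov_smul_right D hσ, secondCov, map_smul]
  exact (smul_sub _ _ _).symm

variable [FiniteDimensional ℝ F]

/-- The curvature at `x` as a bilinear map. -/
def curvForm (x : M) :
    TangentSpace (𝓡 7) x →ₗ[ℝ] TangentSpace (𝓡 7) x →ₗ[ℝ] B x →ₗ[ℝ] B x :=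
  have hsm (b : B x) := eventually_smoothSecAt_extend (F := F) b
  LinearMap.mk₂ ℝ
    (fun u v =>
      { toFun b := curvature D x u v b
        map_add' b b' := by
          have h := commCov_sum_smul D (x := x) (c := fun (_ : Fin 2) _ => 1)
            (τ := ![FiberBundle.extend F b, FiberBundle.extend F b'])
            (fun _ => .of_forall fun _ => contMDiffAt_const)
            (fun a => by fin_cases a <;> exact hsm _) u v
          simp only [Fin.sum_univ_two, one_smul] at h
          rw [curvature_eq_commCov, curvature_eq_commCov, curvature_eq_commCov]
          refine (commCov_eq_of_eq D (hsm _) ?_ ?_ u v).trans h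
          · filter_upwards [hsm b, hsm b'] with z hz hz'
            exact hz.add_section hz'
          · simp
        map_smul' c b := by
          have h := commCov_sum_smul D (x := x) (c := fun (_ : Fin 1) _ => c)
            (τ := fun _ => FiberBundle.extend F b)
            (fun _ => .of_forall fun _ => contMDiffAt_const) (fun a => hsm _) u v
          simp only [Fin.sum_univ_one] at h
          rw [curvature_eq_commCov, curvature_eq_commCov]
          refine (commCov_eq_of_eq D (hsm _) ?_ ?_ u v).trans h
          · filter_upwards [hsm b] with z hz
            exact hz.const_smul_section
          · simp })
    (fun u u' v => by
      ext b
      change curvature D x _ _ _ = curvature D x _ _ _ + curvature D x _ _ _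
      simp only [curvature_eq_commCov, commCov_add_left D (hsm b)])
    (fun c u v => by
      ext b
      change curvature D x _ _ _ = c • curvature D x _ _ _
      simp only [curvature_eq_commCov, commCov_smul_left D (hsm b)])
    (fun u v v' => by
      ext b
      change curvature D x _ _ _ = curvature D x _ _ _ + curvature D x _ _ _
      simp only [curvature_eq_commCov, fun w => commCov_swap D (FiberBundle.extend F b) w u,
        commCov_add_left D (hsm b), neg_add])
    (fun c u v => by
      ext b
      change curvature D x _ _ _ = c • curvature D x _ _ _
      simp only [curvature_eq_commCov, fun w => commCov_swap D (FiberBundle.extend F b) w u,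
        commCov_smul_left D (hsm b), smul_neg])

theorem curvForm_apply (u v : TangentSpace (𝓡 7) x) (b : B x) :
    curvForm D x u v b = curvature D x u v b := rfl

theorem curvForm_swap (u v : TangentSpace (𝓡 7) x) : curvForm D x v u = -curvForm D x u v := by
  ext b
  rw [LinearMap.neg_apply, curvForm_apply, curvForm_apply, curvature_eq_commCov,
    curvature_eq_commCov, commCov_swap]

theorem curvForm_eq_commCov (hσ : ∀ᶠ z in nhds x, SmoothSecAt F σ z) (u v : TangentSpace (𝓡 7) x) :
    curvForm D x u v (σ x) = commCov D σ x u v := by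
  rw [curvForm_apply, curvature_eq_commCov]
  exact commCov_eq_of_eq D (eventually_smoothSecAt_extend _) hσ (by simp) u v

/-- The square of the exterior covariant derivative is exterior multiplication by the curvature. -/
theorem extCov_extCov {k : ℕ} {s : Family B k} (hs : IsSmoothForm F s) (x : M)
    (v : Fin (k + 2) → TangentSpace (𝓡 7) x) :
    extCov D (extCov D s) x v = endWedge (curvForm D x) (hs.form x) v := by
  have hx := mem_chart_source E7 x
  let σ (r : Fin k → TangentSpace (𝓡 7) x) (z : M) : B z := s z fun j => ext (r j) z
  have hσ (r) : ∀ᶠ z in nhds x, SmoothSecAt F (σ r) z :=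
    (eventually_mem_source x).mono fun z hz => hs.smoothSecAt_ext hz r
  have h1 : extCov D (extCov D s) x v = ∑ i : Fin (k + 2), (-1 : ℝ) ^ (i : ℕ) •
      ∑ j : Fin (k + 1), (-1 : ℝ) ^ (j : ℕ) •
        secondCov D (σ (j.removeNth (i.removeNth v))) x (v i) (i.removeNth v j) := by
    rw [extCov_apply D (hs.extCov D)]
    refine Finset.sum_congr rfl fun i _ => congrArg _ ?_
    have hDσ (j : Fin (k + 1)) : MDiffSecAt F (fun z =>
        D (σ (j.removeNth (i.removeNth v))) z (ext (i.removeNth v j) z)) x :=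
      (smoothSecAt_cov D (hσ _) (smoothFieldAt_ext _ hx)).mdiffAt
    refine Eq.trans ?_ (cov_sum_const_smul D Finset.univ hDσ (v i))
    refine congrArg (fun L : TangentSpace (𝓡 7) x →L[ℝ] B x => L (v i)) ?_
    exact cov_congr D ((hs.extCov D).smoothSecAt_ext hx (i.removeNth v)).mdiffAt
      ((eventually_mem_source x).mono fun z hz => extCov_apply_ext D hs hz (i.removeNth v))
  -- The part of the second derivative that is symmetric in the two directions cancels.
  let G (i j : Fin (k + 2)) (r : Fin k → TangentSpace (𝓡 7) x) : B x := (1 / 2 : ℝ) •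
    (secondCov D (σ r) x (v i) (v j) + secondCov D (σ r) x (v j) (v i))
  have h2 := sum_sum_removeNth_eq_zero G (fun i j => by simp only [G, add_comm]) v
  have h3 (i : Fin (k + 2)) (j : Fin (k + 1)) :
      secondCov D (σ (j.removeNth (i.removeNth v))) x (v i) (i.removeNth v j) =
        (1 / 2 : ℝ) • (curvForm D x).compr₂ (compForm (hs.form x)) (v i) (i.removeNth v j)
          (j.removeNth (i.removeNth v)) + G i (i.succAbove j) (j.removeNth (i.removeNth v)) := by
    have h : (curvForm D x).compr₂ (compForm (hs.form x)) (v i) (i.removeNth v j)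
        (j.removeNth (i.removeNth v)) =
          commCov D (σ (j.removeNth (i.removeNth v))) x (v i) (i.removeNth v j) := by
      rw [← curvForm_eq_commCov D (hσ _)]
      simp only [σ, ext_self, hs.apply_eq]
      rfl
    rw [h, commCov]
    simp only [G, Fin.removeNth]
    module
  rw [h1]
  refine (Finset.sum_congr rfl fun i _ => congrArg _
    (Finset.sum_congr rfl fun j _ => congrArg _ (h3 i j))).trans ?_
  simp only [smul_add, Finset.sum_add_distrib]
  rw [h2, add_zero, endWedge, wedgeTwo_apply]
  simp only [Finset.smul_sum]
  refine Finset.sum_congr rfl fun i _ => Finset.sum_congr rfl fun j _ => ?_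
  module

end Curvature

/-! ### Commuting operators -/

section Commutator

variable {M : Type*} [TopologicalSpace M] [ChartedSpace E7 M] [IsManifold (𝓡 7) ∞ M]
variable {F : Type*} [NormedAddCommGroup F] [NormedSpace ℝ F]
  {B : M → Type*} [TopologicalSpace (TotalSpace F B)]
  [∀ x, AddCommGroup (B x)] [∀ x, Module ℝ (B x)] [∀ x, TopologicalSpace (B x)]
  [FiberBundle F B] [VectorBundle ℝ F B]
  {φ : ∀ x : M, TangentSpace (𝓡 7) x [⋀^Fin 3]→ₗ[ℝ] ℝ} {k : ℕ} {s t : Family B k}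

theorem IsSmoothForm.add (hs : IsSmoothForm F s) (ht : IsSmoothForm F t) :
    IsSmoothForm F (fun x v => s x v + t x v) where
  alternating x := ⟨hs.form x + ht.form x, fun v => by
    rw [hs.apply_eq, ht.apply_eq, AlternatingMap.add_apply]⟩
  smooth x X hX := (hs.smooth x X hX).add_section (ht.smooth x X hX)

/-- Every vector is the value of a smooth `0`-form. -/
theorem exists_isSmoothForm_zero [T2Space M]
    [ContMDiffVectorBundle ∞ F B (𝓡 7)] (x : M) (a : TangentSpace (𝓡 7) x [⋀^Fin 0]→ₗ[ℝ] B x) :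
    ∃ (s : Family B 0) (hs : IsSmoothForm F s), hs.form x = a := by
  obtain ⟨τ, hτ, he⟩ := exists_smooth_section (eventually_smoothSecAt_extend (F := F) (a ![]))
  have hs : IsSmoothForm F (fun z _ => τ z : Family B 0) :=
    ⟨fun z => ⟨AlternatingMap.constOfIsEmpty ℝ _ _ (τ z), fun _ => rfl⟩, fun z _ _ => hτ z⟩
  refine ⟨_, hs, ?_⟩
  ext v
  rw [← hs.apply_eq, he.self_of_nhds, FiberBundle.extend_apply_self, Subsingleton.elim v ![]]

variable [∀ x, IsTopologicalAddGroup (B x)] [∀ x, ContinuousSMul ℝ (B x)]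
  (D : CovariantDerivative (𝓡 7) F B)

theorem extCov_add (hs : IsSmoothForm F s) (ht : IsSmoothForm F t) (x : M)
    (v : Fin (k + 1) → TangentSpace (𝓡 7) x) :
    extCov D (fun x v => s x v + t x v) x v = extCov D s x v + extCov D t x v := by
  rw [extCov_apply D (hs.add ht), extCov_apply D hs, extCov_apply D ht, ← Finset.sum_add_distrib]
  refine Finset.sum_congr rfl fun i _ => ?_
  have hx := mem_chart_source E7 x
  have hadd := D.isCovariantDerivativeOnUniv.add
    (hs.smoothSecAt_ext hx (i.removeNth v)).mdiffAt (ht.smoothSecAt_ext hx (i.removeNth v)).mdiffAt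
  rw [← smul_add]
  exact congrArg (fun L : TangentSpace (𝓡 7) x →L[ℝ] B x => (-1 : ℝ) ^ (i : ℕ) • L (v i)) hadd

variable [T2Space M] [ContMDiffVectorBundle ∞ F B (𝓡 7)]
  [FiniteDimensional ℝ F] [D.ContMDiffCovariantDerivative ∞]

/-- The commutator of `∇` and `∇ᶜ` is the commutator of `∇²` and the structure operator, and `∇²`
is multiplication by the curvature. -/
theorem extCov_twisted_eq_iff (hφ : IsG2 φ) (hs : IsSmoothForm F s) :
    extCov D (twisted φ D s) = twisted φ D (extCov D s) ↔
      ∀ x, derivationOp (crossBilin (chartBasis x) (hφ.positive x))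
          (endWedge (curvForm D x) (hs.form x)) =
        endWedge (curvForm D x)
          (derivationOp (crossBilin (chartBasis x) (hφ.positive x)) (hs.form x)) := by
  have hC := hs.structureOp hφ
  have h1 (x : M) (v : Fin (k + 3) → TangentSpace (𝓡 7) x) : extCov D (twisted φ D s) x v =
      extCov D (structureOp φ (extCov D s)) x v + endWedge (curvForm D x)
        (derivationOp (crossBilin (chartBasis x) (hφ.positive x)) (hs.form x)) v := by
    refine (extCov_add D ((hs.extCov D).structureOp hφ) (hC.extCov D) x v).trans ?_
    rw [extCov_extCov D hC]
    congr 3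
    ext w
    rw [← hC.apply_eq, structureOp_eq_derivationOp hφ x _ (hs.apply_eq x)]
  have h2 (x : M) (v : Fin (k + 3) → TangentSpace (𝓡 7) x) : twisted φ D (extCov D s) x v =
      extCov D (structureOp φ (extCov D s)) x v +
        derivationOp (crossBilin (chartBasis x) (hφ.positive x))
          (endWedge (curvForm D x) (hs.form x)) v := by
    rw [twisted, structureOp_eq_derivationOp hφ x _ (extCov_extCov D hs x), add_comm]
  constructor
  · intro h x
    ext v
    have := congrFun (congrFun h x) v
    rw [h1, h2] at this
    exact (add_left_cancel this).symm
  · intro h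
    ext x v
    rw [h1, h2, h]

end Commutator

end GTwo

end

theorem mainTheorem10 {M : Type*} [TopologicalSpace M] [T2Space M] [ChartedSpace GTwo.E7 M]
    [IsManifold (𝓡 7) ∞ M]
    (φ : ∀ x : M, TangentSpace (𝓡 7) x [⋀^Fin 3]→ₗ[ℝ] ℝ) (hφ : GTwo.IsG2 φ)
    {F : Type*} [NormedAddCommGroup F] [NormedSpace ℝ F] [FiniteDimensional ℝ F]
    {B : M → Type*} [TopologicalSpace (TotalSpace F B)]
    [∀ x, AddCommGroup (B x)] [∀ x, Module ℝ (B x)] [∀ x, TopologicalSpace (B x)]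
    [∀ x, IsTopologicalAddGroup (B x)] [∀ x, ContinuousSMul ℝ (B x)] [FiberBundle F B]
    [VectorBundle ℝ F B] [ContMDiffVectorBundle ∞ F B (𝓡 7)]
    (D : CovariantDerivative (𝓡 7) F B) [D.ContMDiffCovariantDerivative ∞] :
    GTwo.IsDonaldsonThomas φ D ↔
      ∀ (k : ℕ) (s : GTwo.Family B k), GTwo.IsSmoothForm F s →
        GTwo.extCov D (GTwo.twisted φ D s) = GTwo.twisted φ D (GTwo.extCov D s) := by
  have hfin (x : M) : FiniteDimensional ℝ (B x) := VectorBundle.finiteDimensional ℝ F B x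
  have hDT (x : M) : GTwo.curvature D x ∈ GTwo.lambda14End B φ x ↔
      ∀ a : TangentSpace (𝓡 7) x [⋀^Fin 0]→ₗ[ℝ] B x,
        GTwo.derivationOp (GTwo.crossBilin (GTwo.chartBasis x) (hφ.positive x))
          (GTwo.endWedge (GTwo.curvForm D x) a) = 0 :=
    GTwo.mem_span_lambda14_iff (GTwo.chartBasis x) (hφ.positive x) (GTwo.curvForm D x)
      (GTwo.curvForm_swap D)
  constructor
  · intro h k s hs
    exact (GTwo.extCov_twisted_eq_iff D hφ hs).2 fun x =>
      GTwo.derivationOp_endWedge_comm (GTwo.chartBasis x) _ _ ((hDT x).1 (h x)) _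
  · intro h x
    refine (hDT x).2 fun a => ?_
    obtain ⟨s, hs, rfl⟩ := GTwo.exists_isSmoothForm_zero (F := F) x a
    rw [(GTwo.extCov_twisted_eq_iff D hφ hs).1 (h 0 s hs) x]
    -- The structure operator vanishes on forms of degree 0.
    change GTwo.endWedge _ 0 = 0
    simpa using GTwo.endWedge_smul (GTwo.curvForm D x) (0 : ℝ) 0
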